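/- Conventions. A connected graph is viewed as a metric space through the path metric $d$ on its vertex set. Connected graphs $X,Y$ are quasi-isometric if there are a map $f$ from the vertices of $X$ to those of $Y$ and constants $L\ge 1$, $A,C\ge 0$ with $\frac1L d(a,b)-A\le d(f(a),f(b))\le L\,d(a,b)+A$ for all $a,b$, and with every vertex of $Y$ within distance $C$ of the image of $f$. For $f,g:\mathbb N\to\mathbb N$ write $f\preceq g$ if there is $c\in\mathbb N$ with $f(n)\le c\,g(cn+c)$ for all $n$. Two locally finite connected graphs have the same growth rate if their growth functions $n\mapsto|B(x,n)|$ (closed balls, any base vertices) satisfy $\preceq$ in both directions; the degree of polynomial growth is the least integer $d\ge 0$ (if there is one) for which the growth function is $\preceq n^d$. The number of ends of $X$ is the supremum in $\mathbb N\cup\{\infty\}$, over bounded sets $B$ of vertices, of the number of unbounded connected components of $X\setminus B$. The asymptotic dimension of $X$ is the least integer $n\ge 0$ such that for every $R\ge 1$ there is a cover of $X$ by sets of uniformly bounded diameter such that every $R$-ball meets at most $n+1$ of them ($\infty$ if there is no such $n$). Theorem. (1) Let $X$ be an infinite, locally finite, connected, vertex-transitive graph. Then there are continuum many pairwise non-quasi-isometric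 connected 3-regular graphs with the same growth rate, number of ends and asymptotic dimension as $X$. More precisely, $X$ contains a bi-infinite geodesic, that is, vertices $(x_n)_{n\in\mathbb Z}$ with $d(x_m,x_n)=|m-n|$ for all $m,n$. Given any such geodesic and $\alpha\in(0,1]$, let $X_\alpha$ be the graph obtained from $X$ by attaching, for each integer $n\ge 1$, a segment of length $\lceil(\log n)^\alpha\rceil$ by one of its endpoints to the vertex $x_{n^2}$. Then $X_\alpha$ is connected, and there are connected 3-regular graphs $Y_\alpha$ $(0<\alpha\le 1)$ such that $Y_\alpha$ is quasi-isometric to $X_\alpha$, $Y_\alpha$ has the same growth rate, number of ends and asymptotic dimension as $X$, and $Y_\alpha$, $Y_\beta$ are not quasi-isometric for $\alpha\ne\beta$. (2) In particular, let $G$ be an infinite, finitely generated nilpotent group. Then there are an integer $d\ge 0$ and a family $(Y_\alpha)_{0<\alpha\le 1}$ of pairwise non-quasi-isometric connected 3-regular graphs such that, for every finite generating set $S$ of $G$, the Cayley graph of $G$ with respect to $S$ and all the graphs $Y_\alpha$ have degree of polynomial growth $d$, and each $Y_\alpha$ has the same growth rate, number of ends and asymptotic dimension as this Cayley graph. -/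

import Mathlib

universe u v

namespace CoarseGraph

/-! Large-scale notions for a connected graph `G`, whose vertex set carries the path metric
`G.dist`. -/

/-- Every vertex has finitely many neighbours. -/
def IsLocallyFinite {V : Type u} (G : SimpleGraph V) : Prop :=
  ∀ a : V, (G.neighborSet a).Finite

/-- Every vertex has exactly three neighbours. -/
def IsThreeRegular {V : Type u} (G : SimpleGraph V) : Prop :=
  ∀ a : V, (G.neighborSet a).encard = 3

/-- The automorphism group acts transitively on the vertices. -/
def IsVertexTransitive {V : Type u} (G : SimpleGraph V) : Prop :=
  ∀ a b : V, ∃ φ : G ≃g G, φ a = b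

/-- `f` is an `(L, A)`-quasi-isometric embedding for the path metrics. -/
def IsQIEmbedding {V : Type u} {W : Type v} (G : SimpleGraph V) (H : SimpleGraph W)
    (L A : ℝ) (f : V → W) : Prop :=
  ∀ a b : V, (1 / L) * (G.dist a b : ℝ) - A ≤ (H.dist (f a) (f b) : ℝ) ∧
    (H.dist (f a) (f b) : ℝ) ≤ L * (G.dist a b : ℝ) + A

/-- There is a coarsely surjective quasi-isometric embedding from `G` to `H`. -/
def QuasiIsometric {V : Type u} {W : Type v} (G : SimpleGraph V) (H : SimpleGraph W) : Prop :=
  ∃ (f : V → W) (L A : ℝ), 1 ≤ L ∧ 0 ≤ A ∧ IsQIEmbedding G H L A f ∧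
    ∃ C : ℝ, 0 ≤ C ∧ ∀ b : W, ∃ a : V, (H.dist (f a) b : ℝ) ≤ C

/-- A set of vertices of finite diameter. -/
def IsBoundedSet {V : Type u} (G : SimpleGraph V) (B : Set V) : Prop :=
  ∃ D : ℕ, ∀ a ∈ B, ∀ b ∈ B, G.dist a b ≤ D

/-- The number of ends: the supremum, over the bounded sets `B` of vertices, of the number of
unbounded connected components of `G \ B`. -/
noncomputable def numEnds {V : Type u} (G : SimpleGraph V) : ℕ∞ :=
  ⨆ (B : Set V) (_ : IsBoundedSet G B),
    {C : G.ComponentCompl B | ¬ IsBoundedSet G (C : Set V)}.encard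

/-- `asdim G ≤ n`: for every `R ≥ 1` there is a uniformly bounded cover such that every ball of
radius `R` meets at most `n + 1` of its members. -/
def AsdimLE {V : Type u} (G : SimpleGraph V) (n : ℕ) : Prop :=
  ∀ R : ℝ, 1 ≤ R → ∃ 𝒰 : Set (Set V),
    (∀ a : V, ∃ U ∈ 𝒰, a ∈ U) ∧
    (∃ D : ℕ, ∀ U ∈ 𝒰, ∀ a ∈ U, ∀ b ∈ U, G.dist a b ≤ D) ∧
    ∀ c : V, {U ∈ 𝒰 | ∃ a ∈ U, (G.dist c a : ℝ) ≤ R}.encard ≤ n + 1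

/-- The asymptotic dimension: the least `n` with `asdim G ≤ n`, and `⊤` if there is none. -/
noncomputable def asdim {V : Type u} (G : SimpleGraph V) : ℕ∞ :=
  ⨅ (n : ℕ) (_ : AsdimLE G n), (n : ℕ∞)

/-- The number of vertices in the closed ball of radius `n` about `a`. -/
noncomputable def growthFun {V : Type u} (G : SimpleGraph V) (a : V) (n : ℕ) : ℕ :=
  {b : V | G.dist a b ≤ n}.ncard

/-- The relation `f ≼ g` on functions `ℕ → ℕ`. -/
def GrowthLE (f g : ℕ → ℕ) : Prop :=
  ∃ c : ℕ, ∀ n : ℕ, f n ≤ c * g (c * n + c)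

/-- `G` and `H` have equivalent growth functions, for all choices of base vertices. -/
def SameGrowthRate {V : Type u} {W : Type v} (G : SimpleGraph V) (H : SimpleGraph W) : Prop :=
  ∀ (a : V) (b : W), GrowthLE (growthFun G a) (growthFun H b) ∧
    GrowthLE (growthFun H b) (growthFun G a)

/-- `G` has polynomial growth, and `d` is the least exponent such that the growth function of `G`
is `≼ n ^ d`, for every choice of the base vertex. -/
def HasPolynomialGrowthOrder {V : Type u} (G : SimpleGraph V) (d : ℕ) : Prop :=
  ∀ a : V, IsLeast {e : ℕ | GrowthLE (growthFun G a) (fun n => n ^ e)} d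

/-- A bi-infinite geodesic, labelled by the integers. -/
def IsGeodesicLine {V : Type u} (G : SimpleGraph V) (x : ℤ → V) : Prop :=
  ∀ m n : ℤ, (G.dist (x m) (x n) : ℤ) = |m - n|

/-- The length `⌈log(n) ^ α⌉` of the `n`-th attached segment. -/
noncomputable def segLength (α : ℝ) (n : ℕ) : ℕ :=
  ⌈(Real.log (n : ℝ)) ^ α⌉₊

/-- The vertices `k_n` (`n ≥ 1`, `1 ≤ k ≤ ⌈log(n) ^ α⌉`) of the attached segments, as pairs
`(n, k)`. The vertex `0_n` is the vertex of the base graph to which the segment is attached. -/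
def SegVertex (α : ℝ) : Type :=
  {p : ℕ × ℕ // 1 ≤ p.1 ∧ 1 ≤ p.2 ∧ p.2 ≤ segLength α p.1}

/-- The adjacency relation of `X_α`. -/
def attachAdj {V : Type u} (X : SimpleGraph V) (x : ℤ → V) (α : ℝ) :
    V ⊕ SegVertex α → V ⊕ SegVertex α → Prop
  | Sum.inl a, Sum.inl b => X.Adj a b
  | Sum.inl a, Sum.inr p => a = x ((p.1.1 : ℤ) ^ 2) ∧ p.1.2 = 1
  | Sum.inr p, Sum.inl a => a = x ((p.1.1 : ℤ) ^ 2) ∧ p.1.2 = 1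
  | Sum.inr p, Sum.inr q => p.1.1 = q.1.1 ∧ (p.1.2 + 1 = q.1.2 ∨ q.1.2 + 1 = p.1.2)

/-- The graph `X_α`: for every `n ≥ 1`, a segment of length `⌈log(n) ^ α⌉` is attached to `X` at
the vertex `x (n ^ 2)`. -/
def attachSegments {V : Type u} (X : SimpleGraph V) (x : ℤ → V) (α : ℝ) :
    SimpleGraph (V ⊕ SegVertex α) where
  Adj := attachAdj X x α
  symm := ⟨by
    rintro (a | p) (b | q) h
    · exact SimpleGraph.Adj.symm h
    · exact h
    · exact h
    · exact ⟨h.1.symm, h.2.symm⟩⟩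
  loopless := ⟨by
    rintro (a | p) h
    · exact SimpleGraph.irrefl X h
    · rcases h.2 with h | h <;> omega⟩

end CoarseGraph

open CoarseGraph

/-! Long geodesics of `X`, translated so that their midpoints sit at a fixed vertex, have a limit
along an ultrafilter; this gives a bi-infinite geodesic (`exists_geodesicLine`).

The attached segments are too sparse to change the invariants. A ball of radius `n` about `x 0`
meets only segments with index at most `√n`, each of length at most `√n`, so it gains at most `n`
vertices, while the geodesic already supplies `n` vertices of `X`. Collapsing the segments has
finite fibres, so the ends survive. The segments are one-dimensional and an unbounded connected
graph has asymptotic dimension at least one, so the dimension survives as well. Bounded degree then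
allows each vertex to be replaced by two cycles, which yields a coarsely equivalent 3-regular graph
(`exists_threeRegular`).

The exponent `α` is a quasi-isometry invariant because dead ends are visible coarsely. The tip of
the `n`-th segment of `X_β` lies in a finite component of the complement of the base vertex. A
quasi-isometry to `X_α` sends it into a finite component of the complement of a ball whose radius
does not depend on `n` (`IsCoarseInverse.finite_component`). By transitivity such components of `X`
reach only a bounded distance (`exists_dist_le_of_finite_component`), so the images of tip and base
project to nearby vertices of `X`, at distance `O(n ^ 2)` from `x 0`. They can be far apart only by
climbing segments of `X_α` of index `O(n)`. Hence `(log n) ^ β` is bounded linearly by `(log (E *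
n)) ^ α` for a constant `E`, which is false for `α < β` (`not_forall_segLength_le`).

For a nilpotent group, collecting commutators bounds the growth by a polynomial
(`exists_wordBall_le`), so a least exponent exists. It does not depend on the generating set, and
the first part applies to a Cayley graph. -/

namespace CoarseGraph

/-! ### Path metrics and local finiteness -/

section Metric

variable {V : Type*} {W : Type*} {G : SimpleGraph V} {H : SimpleGraph W}

theorem dist_le_mul_length (hH : H.Connected) {f : V → W} {K : ℕ}
    (hf : ∀ a b, G.Adj a b → H.dist (f a) (f b) ≤ K) {a b : V} (p : G.Walk a b) :
    H.dist (f a) (f b) ≤ K * p.length := by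
  induction p with
  | nil => simp
  | cons h p ih =>
    have := hH.dist_triangle (u := f _) (v := f _) (w := f _) |>.trans
      (add_le_add (hf _ _ h) ih)
    simp only [SimpleGraph.Walk.length_cons]
    linarith

/-- A map that moves adjacent vertices to vertices at distance at most `K` is `K`-Lipschitz. -/
theorem dist_le_of_adj (hG : G.Connected) (hH : H.Connected) {f : V → W} {K : ℕ}
    (hf : ∀ a b, G.Adj a b → H.dist (f a) (f b) ≤ K) (a b : V) :
    H.dist (f a) (f b) ≤ K * G.dist a b := by
  obtain ⟨p, hp⟩ := hG.exists_walk_length_eq_dist a b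
  rw [← hp]
  exact dist_le_mul_length hH hf p

theorem dist_le_of_hom (hG : G.Connected) (f : G →g H) (a b : V) :
    H.dist (f a) (f b) ≤ G.dist a b := by
  obtain ⟨p, hp⟩ := hG.exists_walk_length_eq_dist a b
  rw [← hp, ← SimpleGraph.Walk.length_map f p]
  exact SimpleGraph.dist_le _

theorem dist_iso (φ : G ≃g H) (a b : V) : H.dist (φ a) (φ b) = G.dist a b := by
  by_cases h : G.Reachable a b
  · apply le_antisymm
    · obtain ⟨p, hp⟩ := h.exists_walk_length_eq_dist
      rw [← hp, ← SimpleGraph.Walk.length_map φ.toHom p]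
      exact SimpleGraph.dist_le _
    · obtain ⟨p, hp⟩ := (h.map φ.toHom).exists_walk_length_eq_dist
      have := SimpleGraph.dist_le (p.map φ.symm.toHom)
      simpa [hp] using this
  · have h' : ¬ H.Reachable (φ a) (φ b) := fun h' => h (by simpa using h'.map φ.symm.toHom)
    rw [SimpleGraph.dist_eq_zero_of_not_reachable h,
      SimpleGraph.dist_eq_zero_of_not_reachable h']

/-- A function with values in `ℕ` that changes by at most one along edges is `1`-Lipschitz. -/
theorem nat_le_add_dist_of_adj (hG : G.Connected) {f : V → ℕ} (hf : ∀ a b, G.Adj a b → f a ≤ f b + 1)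
    (a b : V) : f a ≤ f b + G.dist a b := by
  obtain ⟨p, hp⟩ := hG.exists_walk_length_eq_dist a b
  rw [← hp]
  clear hp
  induction p with
  | nil => simp
  | cons h p ih =>
    have := hf _ _ h
    simp only [SimpleGraph.Walk.length_cons]
    omega

theorem exists_adj_of_dist_eq_succ (hG : G.Connected) {a b : V} {n : ℕ}
    (h : G.dist a b = n + 1) : ∃ c, G.Adj a c ∧ G.dist c b = n := by
  obtain ⟨p, hp⟩ := hG.exists_walk_length_eq_dist a b
  cases p with
  | nil => simp at h
  | @cons _ c _ hac p =>
    refine ⟨c, hac, ?_⟩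
    have h1 := SimpleGraph.dist_le p
    have h2 := hG.dist_triangle (u := a) (v := c) (w := b)
    have h3 := SimpleGraph.dist_eq_one_iff_adj.2 hac
    simp only [SimpleGraph.Walk.length_cons] at hp
    omega

theorem finite_ball (hG : G.Connected) (hl : IsLocallyFinite G) (a : V) (n : ℕ) :
    {b | G.dist a b ≤ n}.Finite := by
  induction n with
  | zero =>
    refine (Set.finite_singleton a).subset fun b hb => ?_
    have : G.dist a b = 0 := by simpa using hb
    exact (hG.dist_eq_zero_iff.1 this).symm
  | succ n ih =>
    refine (ih.union (ih.biUnion fun b _ => hl b)).subset fun b hb => ?_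
    rcases Nat.lt_or_ge (G.dist a b) (n + 1) with h | h
    · exact Or.inl (Nat.lt_succ_iff.1 h)
    · have hb' : G.dist a b = n + 1 := le_antisymm hb h
      rw [SimpleGraph.dist_comm] at hb'
      obtain ⟨c, hc, hd⟩ := exists_adj_of_dist_eq_succ hG hb'
      rw [SimpleGraph.dist_comm] at hd
      exact Or.inr (Set.mem_biUnion (show G.dist a c ≤ n from hd.le) hc.symm)

theorem finite_of_dist_le (hG : G.Connected) (hl : IsLocallyFinite G) {B : Set V} {D : ℕ}
    (h : ∀ a ∈ B, ∀ b ∈ B, G.dist a b ≤ D) : B.Finite := by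
  rcases B.eq_empty_or_nonempty with rfl | ⟨a, ha⟩
  · exact Set.finite_empty
  · exact (finite_ball hG hl a D).subset fun b hb => h a ha b hb

theorem exists_dist_le_of_finite {B : Set V} (h : B.Finite) (a : V) :
    ∃ D : ℕ, ∀ b ∈ B, G.dist a b ≤ D := by
  obtain ⟨D, hD⟩ := (h.image (G.dist a)).bddAbove
  exact ⟨D, fun b hb => hD (Set.mem_image_of_mem _ hb)⟩

/-- Balls are finite. This lets the arguments about ends be run with finite sets and maps with
finite fibres. -/
theorem isBoundedSet_iff_finite (hG : G.Connected) (hl : IsLocallyFinite G) (B : Set V) :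
    IsBoundedSet G B ↔ B.Finite := by
  constructor
  · rintro ⟨D, hD⟩
    exact finite_of_dist_le hG hl hD
  · intro h
    obtain ⟨a⟩ := hG.nonempty
    obtain ⟨D, hD⟩ := exists_dist_le_of_finite (G := G) h a
    refine ⟨D + D, fun b hb c hc => hG.dist_triangle.trans (add_le_add ?_ (hD c hc))⟩
    rw [SimpleGraph.dist_comm]
    exact hD b hb

theorem finite_thickening (hG : G.Connected) (hl : IsLocallyFinite G) {B : Set V}
    (hB : B.Finite) (K : ℕ) : {a | ∃ b ∈ B, G.dist a b ≤ K}.Finite := by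
  refine (hB.biUnion fun b _ => finite_ball hG hl b K).subset ?_
  rintro a ⟨b, hb, h⟩
  rw [SimpleGraph.dist_comm] at h
  exact Set.mem_biUnion hb h

theorem countable_of_locallyFinite (hG : G.Connected) (hl : IsLocallyFinite G) : Countable V := by
  obtain ⟨a⟩ := hG.nonempty
  rw [← Set.countable_univ_iff]
  refine (Set.countable_iUnion fun n => (finite_ball hG hl a n).countable).mono fun b _ => ?_
  exact Set.mem_iUnion.2 ⟨G.dist a b, Nat.le_refl _⟩

theorem exists_dist_gt (hG : G.Connected) (hl : IsLocallyFinite G) [Infinite V] (a : V) (n : ℕ) :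
    ∃ b, n < G.dist a b := by
  by_contra! h
  exact Set.infinite_univ ((finite_ball hG hl a n).subset fun b _ => h b)

end Metric

/-! ### Connectivity in the complement of a set -/

section ReachOff

variable {V : Type*} {W : Type*} {G : SimpleGraph V} {H : SimpleGraph W}

/-- `a` and `b` are joined by a path in the complement of `B`, or are equal. -/
def ReachOff (G : SimpleGraph V) (B : Set V) : V → V → Prop :=
  Relation.ReflTransGen fun a b => G.Adj a b ∧ a ∉ B ∧ b ∉ B

theorem ReachOff.refl (B : Set V) (a : V) : ReachOff G B a a := Relation.ReflTransGen.refl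

theorem ReachOff.trans {B : Set V} {a b c : V} (h : ReachOff G B a b) (h' : ReachOff G B b c) :
    ReachOff G B a c := Relation.ReflTransGen.trans h h'

theorem ReachOff.symm {B : Set V} {a b : V} (h : ReachOff G B a b) : ReachOff G B b a :=
  have : Std.Symm fun a b => G.Adj a b ∧ a ∉ B ∧ b ∉ B :=
    ⟨fun _ _ h => ⟨h.1.symm, h.2.2, h.2.1⟩⟩
  Relation.ReflTransGen.stdSymm.symm _ _ h

theorem ReachOff.single {B : Set V} {a b : V} (h : G.Adj a b) (ha : a ∉ B) (hb : b ∉ B) :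
    ReachOff G B a b := Relation.ReflTransGen.single ⟨h, ha, hb⟩

theorem ReachOff.mono {B C : Set V} (hBC : B ⊆ C) {a b : V} (h : ReachOff G C a b) :
    ReachOff G B a b :=
  Relation.ReflTransGen.mono
    (fun _ _ h => ⟨h.1, fun h' => h.2.1 (hBC h'), fun h' => h.2.2 (hBC h')⟩) _ _ h

theorem ReachOff.lift {B : Set V} {C : Set W} (f : V → W)
    (hf : ∀ a b, G.Adj a b → a ∉ B → b ∉ B → ReachOff H C (f a) (f b)) {a b : V}
    (h : ReachOff G B a b) : ReachOff H C (f a) (f b) := by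
  induction h with
  | refl => exact ReachOff.refl _ _
  | tail _ h ih => exact ih.trans (hf _ _ h.1 h.2.1 h.2.2)

/-- Vertices at distance at most `J` are joined by a path inside the ball of radius `J`. -/
theorem reachOff_of_forall_dist (hG : G.Connected) {B : Set V} (J : ℕ) {a b : V}
    (hab : G.dist a b ≤ J) (hB : ∀ c, G.dist a c ≤ J → c ∉ B) : ReachOff G B a b := by
  induction J generalizing a with
  | zero =>
    obtain rfl := hG.dist_eq_zero_iff.1 (Nat.le_zero.1 hab)
    exact ReachOff.refl _ _
  | succ J ih =>
    rcases Nat.lt_or_ge (G.dist a b) (J + 1) with h | h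
    · exact ih (Nat.lt_succ_iff.1 h) fun c hc => hB c (hc.trans (Nat.le_succ J))
    · obtain ⟨c, hac, hcb⟩ := exists_adj_of_dist_eq_succ hG (le_antisymm hab h)
      have h1 := SimpleGraph.dist_eq_one_iff_adj.2 hac
      refine (ReachOff.single hac (hB a (by simp)) (hB c (by omega))).trans
        (ih hcb.le fun d hd => hB d ?_)
      have := hG.dist_triangle (u := a) (v := c) (w := d)
      omega

/-- Allows components to be handled through paths in the ambient graph, avoiding the induced graph
on a subtype. -/
theorem componentComplMk_eq_iff {B : Set V} {a b : V} (ha : a ∉ B) (hb : b ∉ B) :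
    G.componentComplMk ha = G.componentComplMk hb ↔ ReachOff G B a b := by
  constructor
  · intro h
    have h' : (G.induce Bᶜ).Reachable ⟨a, ha⟩ ⟨b, hb⟩ := SimpleGraph.ConnectedComponent.exact h
    rw [SimpleGraph.reachable_iff_reflTransGen] at h'
    exact Relation.ReflTransGen.lift (fun x : (Bᶜ : Set V) => (x : V))
      (fun x y hxy => ⟨hxy, x.2, y.2⟩) _ _ h'
  · intro h
    induction h with
    | refl => rfl
    | tail h1 h2 ih =>
      exact (ih h2.2.1).trans (SimpleGraph.componentComplMk_eq_of_adj G h2.2.1 hb h2.1)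

end ReachOff

/-! ### Quasi-isometries as pairs of quasi-inverse Lipschitz maps -/

section CoarseEquiv

variable {V : Type*} {W : Type*} {U : Type*} {G : SimpleGraph V} {H : SimpleGraph W}
  {F : SimpleGraph U}

/-- `f` and `g` are mutually quasi-inverse coarse Lipschitz maps, with constant `K`. -/
structure IsCoarseInverse (G : SimpleGraph V) (H : SimpleGraph W) (f : V → W) (g : W → V)
    (K : ℕ) : Prop where
  dist_left : ∀ a b, H.dist (f a) (f b) ≤ K * G.dist a b + K
  dist_right : ∀ a b, G.dist (g a) (g b) ≤ K * H.dist a b + K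
  left_inv : ∀ a, G.dist (g (f a)) a ≤ K
  right_inv : ∀ b, H.dist (f (g b)) b ≤ K

theorem IsCoarseInverse.symm {f : V → W} {g : W → V} {K : ℕ} (h : IsCoarseInverse G H f g K) :
    IsCoarseInverse H G g f K := ⟨h.2, h.1, h.4, h.3⟩

/-- Going to `H` and back moves each point by at most `K`, so the upper bound for `g` becomes a
lower bound for `f`. -/
theorem IsCoarseInverse.dist_le (hG : G.Connected) {f : V → W} {g : W → V} {K : ℕ}
    (h : IsCoarseInverse G H f g K) (a b : V) :
    G.dist a b ≤ K * H.dist (f a) (f b) + 3 * K := by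
  have h1 := hG.dist_triangle (u := a) (v := g (f a)) (w := b)
  have h2 := hG.dist_triangle (u := g (f a)) (v := g (f b)) (w := b)
  have h3 := h.left_inv a
  rw [SimpleGraph.dist_comm] at h3
  have h4 := h.left_inv b
  have h5 := h.dist_right (f a) (f b)
  omega

/-- There are mutually quasi-inverse coarse Lipschitz maps between `G` and `H`. -/
def CoarseEquiv (G : SimpleGraph V) (H : SimpleGraph W) : Prop :=
  ∃ (f : V → W) (g : W → V) (K : ℕ), IsCoarseInverse G H f g K

theorem CoarseEquiv.symm (h : CoarseEquiv G H) : CoarseEquiv H G :=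
  let ⟨f, g, K, h⟩ := h
  ⟨g, f, K, h.symm⟩

theorem CoarseEquiv.trans (hG : G.Connected) (hF : F.Connected)
    (h : CoarseEquiv G H) (h' : CoarseEquiv H F) : CoarseEquiv G F := by
  obtain ⟨f, g, K, h⟩ := h
  obtain ⟨f', g', K', h'⟩ := h'
  have key : ∀ {a b c d : ℕ}, a ≤ K * b + K → b ≤ K' * c + K' → d = 2 * (K * K' + K + K') →
      a ≤ d * c + d := by
    intro a b c d h1 h2 hd
    subst hd
    nlinarith [mul_le_mul_of_nonneg_left h2 (Nat.zero_le K), Nat.zero_le (K * K' * c),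
      Nat.zero_le (K * c), Nat.zero_le (K' * c)]
  have key' : ∀ {a b c d : ℕ}, a ≤ K' * b + K' → b ≤ K * c + K → d = 2 * (K * K' + K + K') →
      a ≤ d * c + d := by
    intro a b c d h1 h2 hd
    subst hd
    nlinarith [mul_le_mul_of_nonneg_left h2 (Nat.zero_le K'), Nat.zero_le (K * K' * c),
      Nat.zero_le (K * c), Nat.zero_le (K' * c)]
  refine ⟨f' ∘ f, g ∘ g', 2 * (K * K' + K + K'), ⟨fun a b => ?_, fun a b => ?_, fun a => ?_,
    fun b => ?_⟩⟩
  · exact key' (h'.dist_left _ _) (h.dist_left _ _) rfl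
  · exact key (h.dist_right _ _) (h'.dist_right _ _) rfl
  · have h1 := hG.dist_triangle (u := g (g' (f' (f a)))) (v := g (f a)) (w := a)
    have h2 := h.dist_right (g' (f' (f a))) (f a)
    have h3 := Nat.mul_le_mul_left K (h'.left_inv (f a))
    have h4 := h.left_inv a
    simp only [Function.comp]
    nlinarith
  · have h1 := hF.dist_triangle (u := f' (f (g (g' b)))) (v := f' (g' b)) (w := b)
    have h2 := h'.dist_left (f (g (g' b))) (g' b)
    have h3 := Nat.mul_le_mul_left K' (h.right_inv (g' b))
    have h4 := h'.right_inv b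
    simp only [Function.comp]
    nlinarith

theorem CoarseEquiv.quasiIsometric (hG : G.Connected) (h : CoarseEquiv G H) :
    QuasiIsometric G H := by
  obtain ⟨f, g, K, h⟩ := h
  refine ⟨f, K + 1, 3 * K + 3, by simp, by positivity, fun a b => ⟨?_, ?_⟩, K, by positivity,
    fun b => ⟨g b, by exact_mod_cast h.right_inv b⟩⟩
  · have h1 : (G.dist a b : ℝ) ≤ K * H.dist (f a) (f b) + 3 * K := by
      exact_mod_cast h.dist_le hG a b
    rw [sub_le_iff_le_add, one_div, inv_mul_le_iff₀ (by positivity)]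
    nlinarith [Nat.cast_nonneg (α := ℝ) K, Nat.cast_nonneg (α := ℝ) (H.dist (f a) (f b))]
  · have h1 : (H.dist (f a) (f b) : ℝ) ≤ K * G.dist a b + K := by
      exact_mod_cast h.dist_left a b
    nlinarith [Nat.cast_nonneg (α := ℝ) K, Nat.cast_nonneg (α := ℝ) (G.dist a b)]

theorem QuasiIsometric.coarseEquiv (hH : H.Connected) (h : QuasiIsometric G H) :
    CoarseEquiv G H := by
  obtain ⟨f, L, A, hL, hA, hf, C, hC, hs⟩ := h
  choose g hg using hs
  have hlow : ∀ a b, (G.dist a b : ℝ) ≤ L * (H.dist (f a) (f b) + A) := fun a b => by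
    have := (hf a b).1
    rwa [sub_le_iff_le_add, one_div, inv_mul_le_iff₀ (by positivity)] at this
  -- Large enough to dominate, at once, both Lipschitz constants and both displacement bounds of the
  -- quasi-inverse chosen by coarse surjectivity.
  obtain ⟨K, hK⟩ := exists_nat_ge (L * (2 * C + A) + L + A + C)
  have hLA : 0 ≤ L * (2 * C + A) := by positivity
  refine ⟨f, g, K, ⟨fun a b => ?_, fun a b => ?_, fun a => ?_, fun b => ?_⟩⟩
  · have h1 := (hf a b).2
    have h2 : L * (G.dist a b : ℝ) ≤ K * G.dist a b :=
      mul_le_mul_of_nonneg_right (by linarith) (by positivity)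
    exact_mod_cast (by linarith : (H.dist (f a) (f b) : ℝ) ≤ K * G.dist a b + K)
  · have h1 := hlow (g a) (g b)
    have h2 : (H.dist (f (g a)) (f (g b)) : ℝ) ≤ C + (H.dist a b + C) := by
      have h3 : (H.dist (f (g a)) (f (g b)) : ℝ) ≤
          H.dist (f (g a)) a + (H.dist a b + H.dist b (f (g b))) := by
        exact_mod_cast hH.dist_triangle.trans (add_le_add le_rfl hH.dist_triangle)
      have h4 := hg a
      have h5 := hg b
      rw [SimpleGraph.dist_comm] at h5
      linarith
    have h6 : L * ((H.dist (f (g a)) (f (g b)) : ℝ) + A) ≤ L * (H.dist a b + (2 * C + A)) :=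
      mul_le_mul_of_nonneg_left (by linarith) (by positivity)
    have h7 : L * (H.dist a b : ℝ) ≤ K * H.dist a b :=
      mul_le_mul_of_nonneg_right (by linarith) (by positivity)
    exact_mod_cast (by linarith : (G.dist (g a) (g b) : ℝ) ≤ K * H.dist a b + K)
  · have h1 := hlow (g (f a)) a
    have h2 : L * ((H.dist (f (g (f a))) (f a) : ℝ) + A) ≤ L * (2 * C + A) :=
      mul_le_mul_of_nonneg_left (by linarith [hg (f a)]) (by positivity)
    exact_mod_cast (by linarith : (G.dist (g (f a)) a : ℝ) ≤ K)
  · exact_mod_cast (by linarith [hg b] : (H.dist (f (g b)) b : ℝ) ≤ K)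

end CoarseEquiv

/-! ### Growth functions -/

section Growth

variable {V : Type*} {W : Type*} {G : SimpleGraph V} {H : SimpleGraph W}

theorem growthFun_mono (hG : G.Connected) (hl : IsLocallyFinite G) (a : V) :
    Monotone (growthFun G a) := fun _ n hmn =>
  Set.ncard_le_ncard (fun _ hb => le_trans (α := ℕ) hb hmn) (finite_ball hG hl a n)

theorem GrowthLE.trans {f g h : ℕ → ℕ} (hh : Monotone h) (hfg : GrowthLE f g)
    (hgh : GrowthLE g h) : GrowthLE f h := by
  obtain ⟨c, hc⟩ := hfg
  obtain ⟨d, hd⟩ := hgh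
  refine ⟨c * d + d, fun n => ?_⟩
  calc f n ≤ c * g (c * n + c) := hc n
    _ ≤ c * (d * h (d * (c * n + c) + d)) := Nat.mul_le_mul_left _ (hd _)
    _ = (c * d) * h (d * (c * n + c) + d) := by ring
    _ ≤ (c * d + d) * h ((c * d + d) * n + (c * d + d)) := by
      refine Nat.mul_le_mul (Nat.le_add_right _ _) (hh ?_)
      nlinarith [Nat.zero_le (d * n)]

/-- A coarsely Lipschitz map with uniformly bounded fibres does not increase growth. -/
theorem growthLE_of_map (hH : H.Connected) (hl : IsLocallyFinite H)
    (f : V → W) (K M : ℕ) (hf : ∀ a b, H.dist (f a) (f b) ≤ K * G.dist a b + K)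
    (hM : ∀ w, {a | f a = w}.encard ≤ M) (a : V) (b : W) :
    GrowthLE (growthFun G a) (growthFun H b) := by
  classical
  refine ⟨K + M + H.dist b (f a), fun n => ?_⟩
  have hfin : ∀ w, {a | f a = w}.Finite := fun w =>
    Set.encard_lt_top_iff.1 ((hM w).trans_lt (WithTop.coe_lt_top _))
  have hball := finite_ball hH hl b (K * n + K + H.dist b (f a))
  have hsub : ∀ c ∈ {c | G.dist a c ≤ n}, f c ∈ hball.toFinset := fun c hc => by
    have h1 := hH.dist_triangle (u := b) (v := f a) (w := f c)
    have h2 := hf a c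
    have h3 := Nat.mul_le_mul_left K (show G.dist a c ≤ n from hc)
    simp only [Set.Finite.mem_toFinset, Set.mem_ofPred_eq]
    omega
  have hs : {c | G.dist a c ≤ n}.Finite :=
    (hball.biUnion fun w _ => hfin w).subset fun c hc =>
      Set.mem_biUnion (by simpa using hsub c hc) rfl
  have h1 : hs.toFinset.card ≤ M * hball.toFinset.card := by
    refine Finset.card_le_mul_card_image_of_maps_to (f := f)
      (fun c hc => hsub c (by simpa using hc)) M fun w _ => ?_
    have h2 := hM w
    rw [(hfin w).encard_eq_coe_toFinset_card, Nat.cast_le] at h2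
    refine (Finset.card_le_card fun c hc => ?_).trans h2
    simpa using (Finset.mem_filter.1 hc).2
  have h2 : growthFun G a n ≤ M * growthFun H b (K * n + K + H.dist b (f a)) := by
    unfold growthFun
    rwa [Set.ncard_eq_toFinset_card _ hs, Set.ncard_eq_toFinset_card _ hball]
  refine h2.trans (Nat.mul_le_mul (by omega) (growthFun_mono hH hl b ?_))
  nlinarith [Nat.zero_le (M * n), Nat.zero_le (H.dist b (f a) * n)]

theorem SameGrowthRate.trans {U : Type*} {F : SimpleGraph U} (hG : G.Connected)
    (hlG : IsLocallyFinite G) (hH : H.Connected)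
    (hF : F.Connected) (hlF : IsLocallyFinite F)
    (h : SameGrowthRate G H) (h' : SameGrowthRate H F) : SameGrowthRate G F := fun a c =>
  let ⟨b⟩ := hH.nonempty
  ⟨(h a b).1.trans (growthFun_mono hF hlF c) (h' b c).1,
    (h' b c).2.trans (growthFun_mono hG hlG a) (h a b).2⟩

end Growth

/-! ### Asymptotic dimension -/

section Asdim

variable {V : Type*} {W : Type*} {G : SimpleGraph V} {H : SimpleGraph W}

/-- Asymptotic dimension is monotone under coarse embeddings. -/
theorem AsdimLE.of_map (f : V → W) (K : ℕ)
    (hf : ∀ a b, H.dist (f a) (f b) ≤ K * G.dist a b + K)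
    (hf' : ∀ D : ℕ, ∃ D' : ℕ, ∀ a b, H.dist (f a) (f b) ≤ D → G.dist a b ≤ D') {n : ℕ}
    (h : AsdimLE H n) : AsdimLE G n := by
  intro R hR
  -- The image of an `R`-ball lies in a ball of radius `K * R + K`; the extra `1` makes the radius
  -- admissible.
  have hR' : (1 : ℝ) ≤ K * R + K + 1 := by
    have : (0 : ℝ) ≤ K := Nat.cast_nonneg K
    nlinarith
  obtain ⟨𝒰, hcov, ⟨D, hD⟩, hmul⟩ := h _ hR'
  obtain ⟨D', hD'⟩ := hf' D
  refine ⟨(f ⁻¹' ·) '' 𝒰, fun a => ?_, ⟨D', ?_⟩, fun c => ?_⟩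
  · obtain ⟨U, hU, ha⟩ := hcov (f a)
    exact ⟨f ⁻¹' U, Set.mem_image_of_mem _ hU, ha⟩
  · rintro _ ⟨U, hU, rfl⟩ a ha b hb
    exact hD' a b (hD U hU _ ha _ hb)
  · refine (Set.encard_le_encard ?_).trans ((Set.encard_image_le (f ⁻¹' ·) _).trans (hmul (f c)))
    rintro _ ⟨⟨U, hU, rfl⟩, a, ha, hca⟩
    refine ⟨U, ⟨hU, f a, ha, ?_⟩, rfl⟩
    have h1 : (H.dist (f c) (f a) : ℝ) ≤ K * G.dist c a + K := by exact_mod_cast hf c a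
    have h2 : (K : ℝ) * G.dist c a ≤ K * R := mul_le_mul_of_nonneg_left hca (by positivity)
    linarith

theorem asdim_le_of_forall (h : ∀ n, AsdimLE H n → AsdimLE G n) : asdim G ≤ asdim H :=
  le_iInf₂ fun n hn => iInf₂_le n (h n hn)

theorem IsCoarseInverse.asdim_le (hG : G.Connected) {f : V → W} {g : W → V} {K : ℕ}
    (h : IsCoarseInverse G H f g K) : asdim G ≤ asdim H :=
  asdim_le_of_forall fun _ => AsdimLE.of_map f K h.dist_left fun D =>
    ⟨K * D + 3 * K, fun a b hab =>
      (h.dist_le hG a b).trans (Nat.add_le_add_right (Nat.mul_le_mul_left K hab) _)⟩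

theorem CoarseEquiv.asdim_eq (hG : G.Connected) (hH : H.Connected) (h : CoarseEquiv G H) :
    asdim G = asdim H := by
  obtain ⟨f, g, K, h⟩ := h
  exact le_antisymm (h.asdim_le hG) (h.symm.asdim_le hH)

/-- An unbounded connected graph does not have asymptotic dimension `0`. -/
theorem not_asdimLE_zero (hG : G.Connected) (hub : ∀ D : ℕ, ∃ a b, D < G.dist a b) :
    ¬ AsdimLE G 0 := by
  intro h
  obtain ⟨𝒰, hcov, ⟨D, hD⟩, hmul⟩ := h 1 le_rfl
  -- A unit ball meets only one member, so members are closed under adjacency and a nonempty one is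
  -- the whole connected graph, contradicting boundedness.
  have key : ∀ U ∈ 𝒰, ∀ a ∈ U, ∀ b, G.Adj a b → b ∈ U := by
    intro U hU a ha b hab
    obtain ⟨U', hU', hb⟩ := hcov b
    have h1 := hmul a
    rw [Nat.cast_zero, zero_add, Set.encard_le_one_iff] at h1
    rw [h1 U U' ⟨hU, a, ha, by simp⟩
      ⟨hU', b, hb, by simp [SimpleGraph.dist_eq_one_iff_adj.2 hab]⟩]
    exact hb
  obtain ⟨a, b, hab⟩ := hub D
  obtain ⟨U, hU, ha⟩ := hcov a
  have : b ∈ U := by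
    have hr := hG.preconnected a b
    rw [SimpleGraph.reachable_iff_reflTransGen] at hr
    clear hab
    induction hr with
    | refl => exact ha
    | tail _ h ih => exact key U hU _ ih _ h
  exact absurd (hD U hU a ha b this) (by omega)

end Asdim

/-! ### Ends -/

section Ends

variable {V : Type*} {W : Type*} {G : SimpleGraph V} {H : SimpleGraph W}

theorem finite_componentCompl (hG : G.Connected) (hl : IsLocallyFinite G) {B : Set V}
    (hB : B.Finite) : Finite (G.ComponentCompl B) := by
  classical
  let : G.LocallyFinite := fun a => (hl a).fintype
  have : Fact G.Preconnected := ⟨hG.preconnected⟩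
  have := G.componentCompl_finite hB.toFinset
  rwa [hB.coe_toFinset] at this

/-- `H` has at most as many ends as `G` if there are a Lipschitz map `g` and a map `h` backwards,
both with finite fibres, such that `w` and `g (h w)` are joined near infinity. -/
theorem numEnds_le_of_map (hG : G.Connected) (hlG : IsLocallyFinite G) (hH : H.Connected)
    (hlH : IsLocallyFinite H) (g : V → W) (h : W → V) (K : ℕ)
    (hg : ∀ a b, G.Adj a b → H.dist (g a) (g b) ≤ K)
    (hgf : ∀ w, {v | g v = w}.Finite) (hhf : ∀ v, {w | h w = v}.Finite)
    (hgh : ∀ B : Set W, B.Finite → {w | ¬ ReachOff H B w (g (h w))}.Finite) :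
    numEnds H ≤ numEnds G := by
  refine iSup₂_le fun B hB => ?_
  rw [isBoundedSet_iff_finite hH hlH] at hB
  -- Chosen so that an edge of `G` avoiding `B'` is sent to a pair joined off `B`: a path of length
  -- at most `K` starting outside the `K`-neighbourhood of `B` misses `B`.
  let B' : Set V := {v | ∃ b ∈ B, H.dist (g v) b ≤ K}
  have hB' : B'.Finite :=
    ((finite_thickening hH hlH hB K).biUnion fun w _ => hgf w).subset fun v hv =>
      Set.mem_biUnion hv rfl
  have hBg : ∀ v ∉ B', g v ∉ B := fun v hv hb => hv (show ∃ b ∈ B, _ from ⟨g v, hb, by simp⟩)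
  have hlift : ∀ {a b}, ReachOff G B' a b → ReachOff H B (g a) (g b) :=
    ReachOff.lift g fun a b hab ha _ =>
      reachOff_of_forall_dist hH K (hg a b hab) fun c hc hcB =>
        ha (show ∃ b ∈ B, _ from ⟨c, hcB, hc⟩)
  have := finite_componentCompl hG hlG hB'
  have key : ∀ C : H.ComponentCompl B, ¬ IsBoundedSet H (C : Set W) →
      ∃ C' : G.ComponentCompl B', ¬ IsBoundedSet G (C' : Set V) ∧
        ∃ v ∈ C', ∃ hv : g v ∉ B, H.componentComplMk hv = C := by
    intro C hC
    rw [isBoundedSet_iff_finite hH hlH] at hC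
    -- Only finitely many points of the infinite component `C` fail these conditions.
    let S : Set W := {w | w ∈ C ∧ ReachOff H B w (g (h w)) ∧ h w ∉ B'}
    have hS : S.Infinite := by
      intro hfin
      refine hC (((hfin.union (hgh B hB)).union (hB'.biUnion fun v _ => hhf v)).subset ?_)
      intro w hw
      by_cases h1 : ReachOff H B w (g (h w))
      · by_cases h2 : h w ∈ B'
        · exact Or.inr (Set.mem_biUnion h2 rfl)
        · exact Or.inl (Or.inl ⟨hw, h1, h2⟩)
      · exact Or.inl (Or.inr h1)
    have hhS : (h '' S).Infinite := fun hfin =>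
      hS ((hfin.biUnion fun v _ => hhf v).subset fun w hw =>
        Set.mem_biUnion (Set.mem_image_of_mem h hw) rfl)
    -- Pigeonhole: the complement of a finite set has finitely many components.
    have hex : ∃ C' : G.ComponentCompl B', (h '' S ∩ (C' : Set V)).Infinite := by
      by_contra! hcon
      refine hhS ((Set.finite_iUnion fun C' => hcon C').subset ?_)
      rintro _ ⟨w, hw, rfl⟩
      exact Set.mem_iUnion.2 ⟨G.componentComplMk hw.2.2, Set.mem_image_of_mem h hw,
        G.componentComplMk_mem hw.2.2⟩
    obtain ⟨C', hC'⟩ := hex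
    refine ⟨C', ?_, ?_⟩
    · rw [isBoundedSet_iff_finite hG hlG]
      exact fun hf => hC' (hf.subset Set.inter_subset_right)
    · obtain ⟨_, ⟨w, hw, rfl⟩, hv⟩ := hC'.nonempty
      refine ⟨h w, hv, hBg _ hw.2.2, ?_⟩
      obtain ⟨hwB, hwC⟩ := SimpleGraph.ComponentCompl.mem_supp_iff.1 hw.1
      exact ((componentComplMk_eq_iff hwB _).2 hw.2.1).symm.trans hwC
  choose Φ hΦ using key
  have hle : {C : H.ComponentCompl B | ¬ IsBoundedSet H (C : Set W)}.encard ≤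
      {C : G.ComponentCompl B' | ¬ IsBoundedSet G (C : Set V)}.encard := by
    -- Injective because `g` maps a component off `B'` into a single component off `B`, so `Φ C`
    -- determines `C`.
    refine Function.Embedding.encard_le ⟨fun C => ⟨Φ C.1 C.2, (hΦ C.1 C.2).1⟩, ?_⟩
    rintro ⟨C, hC⟩ ⟨D, hD⟩ hCD
    obtain ⟨-, a, ha, ha', haC⟩ := hΦ C hC
    obtain ⟨-, b, hb, hb', hbD⟩ := hΦ D hD
    have hCD' : Φ C hC = Φ D hD := congrArg Subtype.val hCD
    rw [← hCD'] at hb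
    refine Subtype.ext ?_
    change C = D
    rw [← haC, ← hbD]
    obtain ⟨ha1, ha2⟩ := SimpleGraph.ComponentCompl.mem_supp_iff.1 ha
    obtain ⟨hb1, hb2⟩ := SimpleGraph.ComponentCompl.mem_supp_iff.1 hb
    exact (componentComplMk_eq_iff _ _).2
      (hlift ((componentComplMk_eq_iff ha1 hb1).1 (ha2.trans hb2.symm)))
  exact hle.trans (le_iSup₂_of_le B' ((isBoundedSet_iff_finite hG hlG B').2 hB') le_rfl)

theorem IsCoarseInverse.finite_fiber (hG : G.Connected) (hl : IsLocallyFinite G) {f : V → W}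
    {g : W → V} {K : ℕ} (h : IsCoarseInverse G H f g K) (w : W) : {v | f v = w}.Finite :=
  finite_of_dist_le hG hl (D := 3 * K) fun a ha b hb => by
    have h1 := h.dist_le hG a b
    rw [show f a = w from ha, show f b = w from hb] at h1
    simpa using h1

theorem IsCoarseInverse.numEnds_le (hG : G.Connected) (hlG : IsLocallyFinite G)
    (hH : H.Connected) (hlH : IsLocallyFinite H) {f : V → W}
    {g : W → V} {K : ℕ} (h : IsCoarseInverse G H f g K) : numEnds H ≤ numEnds G := by
  refine numEnds_le_of_map hG hlG hH hlH f g (2 * K) (fun a b hab => ?_)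
    (h.finite_fiber hG hlG) (h.symm.finite_fiber hH hlH) fun B hB => ?_
  · have := h.dist_left a b
    rw [SimpleGraph.dist_eq_one_iff_adj.2 hab] at this
    omega
  · refine (finite_thickening hH hlH hB K).subset fun w hw => ?_
    by_contra hcon
    refine hw (reachOff_of_forall_dist hH K ?_ fun c hc hcB => hcon ⟨c, hcB, hc⟩)
    rw [SimpleGraph.dist_comm]
    exact h.right_inv w

theorem CoarseEquiv.numEnds_eq (hG : G.Connected) (hlG : IsLocallyFinite G)
    (hH : H.Connected) (hlH : IsLocallyFinite H) (h : CoarseEquiv G H) :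
    numEnds G = numEnds H := by
  obtain ⟨f, g, K, h⟩ := h
  exact le_antisymm (h.symm.numEnds_le hH hlH hG hlG) (h.numEnds_le hG hlG hH hlH)

end Ends

/-! ### Geodesic lines and finite components in vertex-transitive graphs -/

section Transitive

variable {V : Type*} {G : SimpleGraph V}

/-- The three pieces of a shortest walk cut at `i` and `j` have distances bounded by their lengths;
as the lengths add up to the distance of the endpoints, the middle bound is sharp. -/
theorem exists_geodesic_segment (hG : G.Connected) (a b : V) :
    ∃ z : ℕ → V, ∀ i j, i ≤ j → j ≤ G.dist a b → G.dist (z i) (z j) = j - i := by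
  obtain ⟨p, hp⟩ := hG.exists_walk_length_eq_dist a b
  have hle : ∀ k i, i + k ≤ p.length → G.dist (p.getVert i) (p.getVert (i + k)) ≤ k := by
    intro k
    induction k with
    | zero => simp
    | succ k ih =>
      intro i hi
      have h1 := ih i (by omega)
      have h2 := SimpleGraph.dist_eq_one_iff_adj.2 (p.adj_getVert_succ (i := i + k) (by omega))
      have h3 := hG.dist_triangle (u := p.getVert i) (v := p.getVert (i + k))
        (w := p.getVert (i + k + 1))
      rw [← add_assoc]
      omega
  refine ⟨p.getVert, fun i j hij hj => ?_⟩
  rw [← hp] at hj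
  have h1 := hle i 0 (by omega)
  have h2 := hle (j - i) i (by omega)
  have h3 := hle (p.length - j) j (by omega)
  rw [Nat.add_sub_cancel' hij] at h2
  rw [Nat.add_sub_cancel' hj, p.getVert_length] at h3
  rw [zero_add, p.getVert_zero] at h1
  have h4 := hG.dist_triangle (u := a) (v := p.getVert i) (w := b)
  have h5 := hG.dist_triangle (u := p.getVert i) (v := p.getVert j) (w := b)
  omega

/-- An infinite, locally finite, connected, vertex-transitive graph has a bi-infinite geodesic. -/
theorem exists_geodesicLine [Infinite V] (hl : IsLocallyFinite G) (hG : G.Connected)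
    (ht : IsVertexTransitive G) : ∃ x : ℤ → V, IsGeodesicLine G x := by
  obtain ⟨o⟩ := hG.nonempty
  have hy : ∀ n : ℕ, ∃ y : ℤ → V, y 0 = o ∧
      ∀ i j : ℤ, i.natAbs ≤ n → j.natAbs ≤ n → (G.dist (y i) (y j) : ℤ) = |i - j| := by
    intro n
    -- Length above `2 * n` leaves `n` steps on both sides of `z n`, the vertex that is moved to
    -- `o`.
    obtain ⟨b, hb⟩ := exists_dist_gt hG hl o (2 * n)
    obtain ⟨z, hz⟩ := exists_geodesic_segment hG o b
    obtain ⟨φ, hφ⟩ := ht (z n) o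
    have key : ∀ i j : ℤ, i ≤ j → i.natAbs ≤ n → j.natAbs ≤ n →
        (G.dist (z (i + n).toNat) (z (j + n).toNat) : ℤ) = |i - j| := by
      intro i j hij hi hj
      rw [hz _ _ (by omega) (by omega), abs_sub_comm, abs_of_nonneg (by omega)]
      omega
    refine ⟨fun i => φ (z (i + n).toNat), by simpa using hφ, fun i j hi hj => ?_⟩
    rw [dist_iso φ]
    rcases le_total i j with h | h
    · exact key i j h hi hj
    · rw [SimpleGraph.dist_comm, abs_sub_comm]
      exact key j i h hj hi
  choose y hy0 hy using hy
  have hlarge : ∀ i : ℤ, ∀ᶠ n in (Filter.hyperfilter ℕ : Filter ℕ), i.natAbs ≤ n := fun i => by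
    have : ∀ᶠ n in Filter.cofinite, i.natAbs ≤ n := by
      rw [Nat.cofinite_eq_atTop]
      exact Filter.eventually_ge_atTop _
    exact Filter.hyperfilter_le_cofinite this
  have hlim : ∀ i : ℤ, ∃ v, ∀ᶠ n in (Filter.hyperfilter ℕ : Filter ℕ), y n i = v := by
    intro i
    -- For large `n` the vertex `y n i` lies in a fixed finite ball, so the ultrafilter selects one
    -- value; coherence in `i` is automatic.
    have h1 : (⋃ v ∈ {v | G.dist o v ≤ i.natAbs}, {n | y n i = v}) ∈ Filter.hyperfilter ℕ := by
      refine Filter.mem_of_superset (hlarge i) fun n hn => ?_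
      refine Set.mem_biUnion (x := y n i) ?_ rfl
      have := hy n 0 i (by simp) hn
      rw [hy0 n, zero_sub, abs_neg, Int.abs_eq_natAbs] at this
      show G.dist o (y n i) ≤ _
      omega
    obtain ⟨v, -, hv⟩ := (Ultrafilter.finite_biUnion_mem_iff (finite_ball hG hl o _)).1 h1
    exact ⟨v, hv⟩
  choose x hx using hlim
  refine ⟨x, fun i j => ?_⟩
  obtain ⟨n, h1, h2, h3, h4⟩ :=
    ((hx i).and ((hx j).and ((hlarge i).and (hlarge j)))).exists
  rw [← h1, ← h2]
  exact hy n i j h3 h4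

/-- In a vertex-transitive graph the finite components of the complement of a ball of radius `r`
stay within a distance of the centre that depends only on `r`. -/
theorem exists_dist_le_of_finite_component (hl : IsLocallyFinite G) (hG : G.Connected)
    (ht : IsVertexTransitive G) (r : ℕ) : ∃ D : ℕ, ∀ v c : V,
      {d | ReachOff G {a | G.dist v a ≤ r} c d}.Finite → G.dist v c ≤ D := by
  obtain ⟨o⟩ := hG.nonempty
  let B : Set V := {a | G.dist o a ≤ r}
  -- Every component outside the ball touches the sphere of radius `r + 1`, so the finite ones are
  -- finitely many and their union is finite. Automorphisms carry the resulting bound to all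
  -- centres.
  let S : Set V := {u | G.dist o u ≤ r + 1 ∧ {d | ReachOff G B u d}.Finite}
  have hS : S.Finite := (finite_ball hG hl o (r + 1)).subset fun u hu => hu.1
  have hT : (⋃ u ∈ S, {d | ReachOff G B u d}).Finite := hS.biUnion fun u hu => hu.2
  obtain ⟨D, hD⟩ := exists_dist_le_of_finite (G := G) hT o
  have hcase : ∀ n c, G.dist c o = n → r < n → ∃ u, G.dist o u = r + 1 ∧ ReachOff G B c u := by
    intro n
    induction n with
    | zero => intro c _ h; omega
    | succ n ih =>
      intro c hc hn
      rcases Nat.lt_or_ge r n with h | h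
      · obtain ⟨c', hcc, hc'⟩ := exists_adj_of_dist_eq_succ hG hc
        obtain ⟨u, hu, hr⟩ := ih c' hc' h
        refine ⟨u, hu, (ReachOff.single hcc ?_ ?_).trans hr⟩ <;>
        · intro hB
          have : G.dist o _ ≤ r := hB
          rw [SimpleGraph.dist_comm] at this
          omega
      · refine ⟨c, ?_, ReachOff.refl _ _⟩
        rw [SimpleGraph.dist_comm]
        omega
  -- The `r` covers vertices `c` inside the ball, where `ReachOff` reaches only `c` itself.
  refine ⟨max r D, fun v c hfin => ?_⟩
  obtain ⟨φ, rfl⟩ : ∃ φ : G ≃g G, φ o = v := ht o v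
  obtain ⟨c, rfl⟩ := φ.surjective c
  rw [dist_iso]
  have hfin' : {d | ReachOff G B c d}.Finite := by
    refine Set.Finite.of_injOn (f := φ) (fun d hd => ?_) φ.injective.injOn hfin
    refine ReachOff.lift φ (fun a b hab ha hb => ReachOff.single (φ.map_adj_iff.2 hab) ?_ ?_) hd
    · intro h; exact ha (by rw [Set.mem_ofPred_eq, dist_iso] at h; exact h)
    · intro h; exact hb (by rw [Set.mem_ofPred_eq, dist_iso] at h; exact h)
  rcases Nat.lt_or_ge r (G.dist o c) with h | h
  · obtain ⟨u, hu, hr⟩ := hcase _ c rfl (by rwa [SimpleGraph.dist_comm])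
    refine le_max_of_le_right (hD c (Set.mem_biUnion (x := u) ⟨hu.le, ?_⟩ hr.symm))
    exact hfin'.subset fun d hd => hr.trans hd
  · exact le_max_of_le_left h

end Transitive

/-! ### The graph with attached segments and its coarse invariants -/

section Attach

variable {V : Type*} {X : SimpleGraph V} {x : ℤ → V} {α : ℝ}

/-- Crude, but sufficient: attached at squares, segments of length up to their index still
contribute only linear growth. -/
theorem segLength_le (h0 : 0 < α) (h1 : α ≤ 1) {n : ℕ} (hn : 1 ≤ n) : segLength α n ≤ n := by
  have hn' : (1 : ℝ) ≤ n := by exact_mod_cast hn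
  refine Nat.ceil_le.2 ?_
  have hlog : 0 ≤ Real.log n := Real.log_nonneg hn'
  rcases le_total (Real.log n) 1 with h | h
  · exact (Real.rpow_le_one hlog h h0.le).trans hn'
  · calc Real.log n ^ α ≤ Real.log n ^ (1 : ℝ) := Real.rpow_le_rpow_of_exponent_le h h1
      _ = Real.log n := Real.rpow_one _
      _ ≤ n - 1 := Real.log_le_sub_one_of_pos (by linarith)
      _ ≤ n := by linarith

/-- The retraction of `X_α` onto `X` that collapses every segment to its base vertex. -/
def segProj (x : ℤ → V) : V ⊕ SegVertex α → V :=
  Sum.elim id fun p => x ((p.1.1 : ℤ) ^ 2)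

/-- The height above the base on the `n`-th segment, and `0` elsewhere. -/
def segHeight (n : ℕ) : V ⊕ SegVertex α → ℕ :=
  Sum.elim (fun _ => 0) fun p => if p.1.1 = n then p.1.2 else 0

@[simp] theorem segProj_inl (x : ℤ → V) (a : V) :
    segProj x (Sum.inl a : V ⊕ SegVertex α) = a := rfl

@[simp] theorem segProj_inr (x : ℤ → V) (p : SegVertex α) :
    segProj x (Sum.inr p : V ⊕ SegVertex α) = x ((p.1.1 : ℤ) ^ 2) := rfl

@[simp] theorem segHeight_inl (n : ℕ) (a : V) :
    segHeight n (Sum.inl a : V ⊕ SegVertex α) = 0 := rfl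

@[simp] theorem segHeight_inr (n : ℕ) (p : SegVertex α) :
    segHeight n (Sum.inr p : V ⊕ SegVertex α) = if p.1.1 = n then p.1.2 else 0 := rfl

/-- The inclusion of `X` into `X_α`. -/
def attachInl (X : SimpleGraph V) (x : ℤ → V) (α : ℝ) : X →g attachSegments X x α :=
  ⟨Sum.inl, fun h => h⟩

theorem attach_adj_inr_inl (p : SegVertex α) (hp : p.1.2 = 1) :
    (attachSegments X x α).Adj (Sum.inr p) (Sum.inl (x ((p.1.1 : ℤ) ^ 2))) := ⟨rfl, hp⟩

theorem attach_adj_inr_inr (p q : SegVertex α) (h1 : p.1.1 = q.1.1) (h2 : p.1.2 + 1 = q.1.2) :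
    (attachSegments X x α).Adj (Sum.inr q) (Sum.inr p) := ⟨h1.symm, Or.inr h2⟩

theorem exists_segVertex_below (p : SegVertex α) {k : ℕ} (hk : 1 ≤ k) (hk' : k ≤ p.1.2) :
    ∃ q : SegVertex α, q.1.1 = p.1.1 ∧ q.1.2 = k :=
  ⟨⟨(p.1.1, k), p.2.1, hk, hk'.trans p.2.2.2⟩, rfl, rfl⟩

theorem segProj_adj {a b : V ⊕ SegVertex α} (h : (attachSegments X x α).Adj a b) :
    segProj x a = segProj x b ∨ X.Adj (segProj x a) (segProj x b) := by
  rcases a with a | p <;> rcases b with b | q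
  · exact Or.inr h
  · exact Or.inl h.1
  · exact Or.inl h.1.symm
  · exact Or.inl (by simp [show p.1.1 = q.1.1 from h.1])

theorem segHeight_adj (n : ℕ) {a b : V ⊕ SegVertex α} (h : (attachSegments X x α).Adj a b) :
    segHeight n a ≤ segHeight n b + 1 := by
  rcases a with a | p <;> rcases b with b | q
  · simp
  · simp
  · have : p.1.2 = 1 := h.2
    simp only [segHeight_inr, segHeight_inl]
    split_ifs <;> omega
  · obtain ⟨h1, h2⟩ : p.1.1 = q.1.1 ∧ (p.1.2 + 1 = q.1.2 ∨ q.1.2 + 1 = p.1.2) := h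
    simp only [segHeight_inr, h1]
    split_ifs <;> omega

/-- A vertex of a segment is joined to the base inside the fibre of the projection. -/
theorem reachOff_segProj (B : Set (V ⊕ SegVertex α)) (a : V ⊕ SegVertex α)
    (h : ∀ b, segProj x b = segProj x a → b ∉ B) :
    ReachOff (attachSegments X x α) B a (Sum.inl (segProj x a)) := by
  rcases a with a | p
  · exact ReachOff.refl _ _
  · have key : ∀ k, ∀ p : SegVertex α, p.1.2 = k + 1 →
        (∀ b, segProj x b = x ((p.1.1 : ℤ) ^ 2) → b ∉ B) →
        ReachOff (attachSegments X x α) B (Sum.inr p) (Sum.inl (x ((p.1.1 : ℤ) ^ 2))) := by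
      intro k
      induction k with
      | zero =>
        intro p hp hB
        exact ReachOff.single (attach_adj_inr_inl p hp) (hB _ rfl) (hB _ rfl)
      | succ k ih =>
        intro p hp hB
        obtain ⟨q, hq1, hq2⟩ := exists_segVertex_below p (k := k + 1) (by omega) (by omega)
        have h1 := ih q hq2 (by rwa [hq1])
        rw [hq1] at h1
        exact (ReachOff.single (attach_adj_inr_inr q p hq1 (by omega)) (hB _ rfl)
          (hB _ (by simp [hq1]))).trans h1
    obtain ⟨k, hk⟩ := Nat.exists_eq_add_of_le' p.2.2.1
    exact key k p hk h

theorem attachSegments_connected (hX : X.Connected) : (attachSegments X x α).Connected := by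
  obtain ⟨o⟩ := hX.nonempty
  have h1 : ∀ a : V ⊕ SegVertex α,
      (attachSegments X x α).Reachable a (Sum.inl (segProj x a)) := fun a => by
    rw [SimpleGraph.reachable_iff_reflTransGen]
    exact Relation.ReflTransGen.mono (fun _ _ h => h.1) _ _
      (reachOff_segProj (X := X) ∅ a fun _ _ => Set.notMem_empty _)
  have : Nonempty (V ⊕ SegVertex α) := ⟨Sum.inl o⟩
  refine ⟨fun a b => (h1 a).trans (SimpleGraph.Reachable.trans ?_ (h1 b).symm)⟩
  exact (hX.preconnected _ _).map (attachInl X x α)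

theorem dist_segProj_le (hX : X.Connected) (a b : V ⊕ SegVertex α) :
    X.dist (segProj x a) (segProj x b) ≤ (attachSegments X x α).dist a b := by
  have := dist_le_of_adj (attachSegments_connected (x := x) (α := α) hX) hX
    (f := segProj x) (K := 1) (fun a b hab => by
      rcases segProj_adj hab with h | h
      · simp [h]
      · exact (SimpleGraph.dist_eq_one_iff_adj.2 h).le) a b
  simpa using this

theorem dist_attach_inl_le (hX : X.Connected) (a b : V) :
    (attachSegments X x α).dist (Sum.inl a) (Sum.inl b) ≤ X.dist a b :=
  dist_le_of_hom hX (attachInl X x α) a b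

theorem segHeight_le (hX : X.Connected) (n : ℕ) (a b : V ⊕ SegVertex α) :
    segHeight n a ≤ segHeight n b + (attachSegments X x α).dist a b :=
  nat_le_add_dist_of_adj (attachSegments_connected hX) (fun _ _ h => segHeight_adj n h) a b

theorem dist_inr_inr_le (hX : X.Connected) (k : ℕ) (p q : SegVertex α) (h1 : p.1.1 = q.1.1)
    (h2 : p.1.2 + k = q.1.2) :
    (attachSegments X x α).dist (Sum.inr q) (Sum.inr p) ≤ k := by
  induction k generalizing q with
  | zero =>
    obtain rfl : p = q := Subtype.ext (Prod.ext h1 h2)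
    simp
  | succ k ih =>
    obtain ⟨q', hq1, hq2⟩ := exists_segVertex_below q (k := p.1.2 + k)
      (by have := p.2.2.1; omega) (by omega)
    have h3 := ih q' (by omega) (by omega)
    have h4 := SimpleGraph.dist_eq_one_iff_adj.2
      (attach_adj_inr_inr (X := X) (x := x) q' q hq1 (by omega))
    have := (attachSegments_connected (x := x) (α := α) hX).dist_triangle
      (u := Sum.inr q) (v := Sum.inr q') (w := Sum.inr p)
    omega

theorem dist_inr_segProj_le (hX : X.Connected) (p : SegVertex α) :
    (attachSegments X x α).dist (Sum.inr p) (Sum.inl (x ((p.1.1 : ℤ) ^ 2))) ≤ p.1.2 := by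
  have hp := p.2.2.1
  obtain ⟨q, hq1, hq2⟩ := exists_segVertex_below p (k := 1) le_rfl hp
  have h1 := dist_inr_inr_le (x := x) hX (p.1.2 - 1) q p hq1 (by omega)
  have h2 := SimpleGraph.dist_eq_one_iff_adj.2 (attach_adj_inr_inl (X := X) (x := x) q hq2)
  rw [hq1] at h2
  have := (attachSegments_connected (x := x) (α := α) hX).dist_triangle
    (u := Sum.inr p) (v := Sum.inr q) (w := Sum.inl (x ((p.1.1 : ℤ) ^ 2)))
  omega

theorem sq_eq_dist (hx : IsGeodesicLine X x) (n : ℕ) :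
    X.dist (x 0) (x ((n : ℤ) ^ 2)) = n ^ 2 := by
  have h := hx 0 ((n : ℤ) ^ 2)
  rw [zero_sub, abs_neg, abs_of_nonneg (by positivity)] at h
  exact_mod_cast h

theorem finite_segVertex_le (h0 : 0 < α) (h1 : α ≤ 1) (N : ℕ) :
    {p : SegVertex α | p.1.1 ≤ N}.Finite := by
  refine Set.Finite.subset (((Set.finite_Iic N).prod (Set.finite_Iic N)).preimage
    (f := fun p : SegVertex α => p.1) Subtype.val_injective.injOn) fun p hp => ?_
  exact ⟨hp, (p.2.2.2.trans (segLength_le h0 h1 p.2.1)).trans hp⟩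

theorem finite_segProj_fiber (hx : IsGeodesicLine X x) (h0 : 0 < α) (h1 : α ≤ 1) (v : V) :
    {a : V ⊕ SegVertex α | segProj x a = v}.Finite := by
  refine ((Set.finite_singleton (Sum.inl v)).union
    ((finite_segVertex_le h0 h1 (X.dist (x 0) v)).image Sum.inr)).subset ?_
  rintro (a | p) h
  · exact Or.inl (congrArg Sum.inl h)
  · refine Or.inr (Set.mem_image_of_mem _ ?_)
    have h2 : x ((p.1.1 : ℤ) ^ 2) = v := h
    have h3 := sq_eq_dist hx p.1.1
    rw [h2] at h3
    show p.1.1 ≤ _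
    nlinarith

/-- Distinct squares give distinct vertices of the geodesic, so a vertex of `X` gains at most one
neighbour. The `3` is a common slack that also covers vertices on segments. -/
theorem attach_encard_neighborSet_le (hx : IsGeodesicLine X x) {Δ : ℕ}
    (hΔ : ∀ a, (X.neighborSet a).encard ≤ Δ) (a : V ⊕ SegVertex α) :
    ((attachSegments X x α).neighborSet a).encard ≤ (Δ + 3 : ℕ) := by
  rcases a with a | p
  · have hsub : (attachSegments X x α).neighborSet (Sum.inl a) ⊆
        Sum.inl '' X.neighborSet a ∪ Sum.inr '' {p | a = x ((p.1.1 : ℤ) ^ 2) ∧ p.1.2 = 1} := by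
      rintro (b | p) h
      · exact Or.inl (Set.mem_image_of_mem _ h)
      · exact Or.inr (Set.mem_image_of_mem _ h)
    have h1 : (Sum.inr '' {p | a = x ((p.1.1 : ℤ) ^ 2) ∧ p.1.2 = 1} :
        Set (V ⊕ SegVertex α)).encard ≤ 1 := by
      refine (Set.encard_image_le _ _).trans (Set.encard_le_one_iff.2 ?_)
      rintro p q ⟨hp1, hp2⟩ ⟨hq1, hq2⟩
      refine Subtype.ext (Prod.ext ?_ (hp2.trans hq2.symm))
      have h2 := sq_eq_dist hx p.1.1
      have h3 := sq_eq_dist hx q.1.1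
      rw [← hp1] at h2
      rw [← hq1] at h3
      exact Nat.pow_left_injective (n := 2) (by norm_num) (h2.symm.trans h3)
    calc _ ≤ _ := Set.encard_le_encard hsub
      _ ≤ _ := Set.encard_union_le _ _
      _ ≤ (Δ : ℕ∞) + 1 := add_le_add ((Set.encard_image_le _ _).trans (hΔ a)) h1
      _ ≤ _ := by norm_cast; omega
  · have hsub : (attachSegments X x α).neighborSet (Sum.inr p) ⊆
        {Sum.inl (x ((p.1.1 : ℤ) ^ 2))} ∪
          (Sum.inr '' {q | p.1.1 = q.1.1 ∧ p.1.2 + 1 = q.1.2} ∪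
            Sum.inr '' {q | p.1.1 = q.1.1 ∧ q.1.2 + 1 = p.1.2}) := by
      rintro (b | q) h
      · exact Or.inl (congrArg Sum.inl h.1)
      · rcases h with ⟨h1, h2 | h2⟩
        · exact Or.inr (Or.inl (Set.mem_image_of_mem _ ⟨h1, h2⟩))
        · exact Or.inr (Or.inr (Set.mem_image_of_mem _ ⟨h1, h2⟩))
    have h1 : (Sum.inr '' {q | p.1.1 = q.1.1 ∧ p.1.2 + 1 = q.1.2} :
        Set (V ⊕ SegVertex α)).encard ≤ 1 := by
      refine (Set.encard_image_le _ _).trans (Set.encard_le_one_iff.2 ?_)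
      rintro q q' ⟨h1, h2⟩ ⟨h3, h4⟩
      exact Subtype.ext (Prod.ext (h1.symm.trans h3) (h2.symm.trans h4))
    have h2 : (Sum.inr '' {q | p.1.1 = q.1.1 ∧ q.1.2 + 1 = p.1.2} :
        Set (V ⊕ SegVertex α)).encard ≤ 1 := by
      refine (Set.encard_image_le _ _).trans (Set.encard_le_one_iff.2 ?_)
      rintro q q' ⟨h1, h2⟩ ⟨h3, h4⟩
      exact Subtype.ext (Prod.ext (h1.symm.trans h3) (by omega))
    calc _ ≤ _ := Set.encard_le_encard hsub
      _ ≤ _ := Set.encard_union_le _ _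
      _ ≤ _ := add_le_add_right (Set.encard_union_le _ _) _
      _ ≤ (1 : ℕ∞) + (1 + 1) := add_le_add (Set.encard_singleton _).le (add_le_add h1 h2)
      _ ≤ _ := by norm_cast; omega

theorem isLocallyFinite_of_encard_le {W : Type*} {G : SimpleGraph W} {Δ : ℕ}
    (hΔ : ∀ a, (G.neighborSet a).encard ≤ Δ) : IsLocallyFinite G := fun a =>
  Set.encard_lt_top_iff.1 ((hΔ a).trans_lt (WithTop.coe_lt_top _))

theorem exists_encard_neighborSet_le (hX : X.Connected) (hl : IsLocallyFinite X)
    (ht : IsVertexTransitive X) : ∃ Δ : ℕ, ∀ a, (X.neighborSet a).encard ≤ Δ := by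
  obtain ⟨o⟩ := hX.nonempty
  refine ⟨(X.neighborSet o).ncard, fun a => ?_⟩
  rw [(hl o).cast_ncard_eq]
  obtain ⟨φ, hφ⟩ := ht a o
  refine Set.encard_le_encard_of_injOn (f := φ) (fun b hb => ?_) φ.injective.injOn
  rw [← hφ]
  exact φ.map_adj_iff.2 hb

theorem attachSegments_sameGrowthRate (hX : X.Connected) (hl : IsLocallyFinite X)
    (hx : IsGeodesicLine X x) (h0 : 0 < α) (h1 : α ≤ 1)
    (hl' : IsLocallyFinite (attachSegments X x α)) :
    SameGrowthRate (attachSegments X x α) X := by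
  have hc := attachSegments_connected (x := x) (α := α) hX
  intro a b
  constructor
  · have hA : GrowthLE (growthFun (attachSegments X x α) a)
        (growthFun (attachSegments X x α) (Sum.inl (x 0))) :=
      growthLE_of_map hc hl' id 1 1 (fun a b => by simp) (fun w => by simp) _ _
    have hC : GrowthLE (growthFun X (x 0)) (growthFun X b) :=
      growthLE_of_map hX hl id 1 1 (fun a b => by simp) (fun w => by simp) _ _
    have hB : GrowthLE (growthFun (attachSegments X x α) (Sum.inl (x 0)))
        (growthFun X (x 0)) := by
      refine ⟨2, fun n => ?_⟩
      have hfin := finite_ball hX hl (x 0) n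
      -- Both the index and the height of such a vertex are at most `√n`.
      have hseg : {p : SegVertex α | p.1.1 ^ 2 ≤ n}.ncard ≤ n := by
        have h2 : {p : SegVertex α | p.1.1 ^ 2 ≤ n}.ncard ≤
            (((Finset.Icc 1 n.sqrt ×ˢ Finset.Icc 1 n.sqrt : Finset (ℕ × ℕ)) :
              Set (ℕ × ℕ))).ncard := by
          refine Set.ncard_le_ncard_of_injOn (fun p : SegVertex α => p.1) (fun p hp => ?_)
            Subtype.val_injective.injOn (Finset.finite_toSet _)
          have h3 : p.1.1 ≤ n.sqrt := Nat.le_sqrt'.2 hp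
          have h4 := p.2.2.2.trans (segLength_le h0 h1 p.2.1)
          have h5 := p.2.1
          have h6 := p.2.2.1
          simp only [Finset.coe_product, Finset.coe_Icc, Set.mem_prod, Set.mem_Icc]
          omega
        rw [Set.ncard_coe_finset, Finset.card_product, Nat.card_Icc, Nat.add_sub_cancel] at h2
        exact h2.trans (Nat.sqrt_le n)
      have hsegf : {p : SegVertex α | p.1.1 ^ 2 ≤ n}.Finite :=
        (finite_segVertex_le h0 h1 n).subset fun p hp => by
          have : p.1.1 ^ 2 ≤ n := hp
          show p.1.1 ≤ n
          nlinarith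
      -- The geodesic ray from `x 0` absorbs the linear contribution of the segments.
      have hn : n ≤ growthFun X (x 0) n := by
        have h2 : ((Finset.range n : Finset ℕ) : Set ℕ).ncard ≤ growthFun X (x 0) n := by
          refine Set.ncard_le_ncard_of_injOn (fun i : ℕ => x i) (fun i hi => ?_) ?_ hfin
          · have h3 := hx 0 i
            rw [zero_sub, abs_neg, Nat.abs_cast] at h3
            have h4 : i < n := by simpa using hi
            show X.dist (x 0) (x i) ≤ n
            omega
          · intro i _ j _ hij
            have h3 := hx i j
            rw [show x i = x j from hij, SimpleGraph.dist_self] at h3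
            have := abs_eq_zero.1 h3.symm
            omega
        rwa [Set.ncard_coe_finset, Finset.card_range] at h2
      have hsub : {c | (attachSegments X x α).dist (Sum.inl (x 0)) c ≤ n} ⊆
          Sum.inl '' {c | X.dist (x 0) c ≤ n} ∪ Sum.inr '' {p : SegVertex α | p.1.1 ^ 2 ≤ n} := by
        intro c hcn
        have h2 := (dist_segProj_le (x := x) hX (Sum.inl (x 0)) c).trans hcn
        rcases c with c | p
        · exact Or.inl (Set.mem_image_of_mem _ h2)
        · rw [segProj_inl, segProj_inr, sq_eq_dist hx] at h2
          exact Or.inr (Set.mem_image_of_mem _ h2)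
      calc growthFun (attachSegments X x α) (Sum.inl (x 0)) n
          ≤ _ := Set.ncard_le_ncard hsub ((hfin.image _).union (hsegf.image _))
        _ ≤ _ := Set.ncard_union_le _ _
        _ ≤ growthFun X (x 0) n + n :=
          add_le_add (Set.ncard_image_le hfin) ((Set.ncard_image_le hsegf).trans hseg)
        _ ≤ 2 * growthFun X (x 0) n := by omega
        _ ≤ _ := Nat.mul_le_mul_left 2 (growthFun_mono hX hl _ (by omega))
    exact (hA.trans (growthFun_mono hX hl _) hB).trans (growthFun_mono hX hl b) hC
  · refine growthLE_of_map hc hl' Sum.inl 1 1 (fun a b => ?_) (fun w => ?_) _ _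
    · have := dist_attach_inl_le (x := x) (α := α) hX a b
      omega
    · rw [Nat.cast_one, Set.encard_le_one_iff]
      intro c d hc hd
      exact Sum.inl_injective (hc.trans hd.symm)

/-- The inclusion and the collapse are the two maps of `numEnds_le_of_map`. A vertex is joined to
its base within its fibre, which meets a given finite set for only finitely many vertices. -/
theorem attachSegments_numEnds (hX : X.Connected) (hl : IsLocallyFinite X)
    (hx : IsGeodesicLine X x) (h0 : 0 < α) (h1 : α ≤ 1)
    (hl' : IsLocallyFinite (attachSegments X x α)) :
    numEnds (attachSegments X x α) = numEnds X := by
  have hc := attachSegments_connected (x := x) (α := α) hX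
  have hfib := finite_segProj_fiber (α := α) hx h0 h1
  have hfib' : ∀ w : V ⊕ SegVertex α, {v | Sum.inl v = w}.Finite := fun w =>
    Set.Subsingleton.finite fun a ha b hb => Sum.inl_injective (Eq.trans ha hb.symm)
  apply le_antisymm
  · refine numEnds_le_of_map hX hl hc hl' Sum.inl (segProj x) 1 (fun a b hab => ?_) hfib' hfib
      fun B hB => ?_
    · exact (dist_attach_inl_le hX a b).trans (SimpleGraph.dist_eq_one_iff_adj.2 hab).le
    · refine ((hB.image (segProj x)).biUnion fun v _ => hfib v).subset fun w hw => ?_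
      by_contra hcon
      refine hw (reachOff_segProj B w fun b hb hbB => hcon ?_)
      exact Set.mem_biUnion (Set.mem_image_of_mem (segProj x) hbB) hb.symm
  · refine numEnds_le_of_map hc hl' hX hl (segProj x) Sum.inl 1 (fun a b hab => ?_) hfib hfib'
      fun B _ => ?_
    · exact (dist_segProj_le hX a b).trans (SimpleGraph.dist_eq_one_iff_adj.2 hab).le
    · refine Set.finite_empty.subset fun w hw => hw (ReachOff.refl _ _)

/-- Each segment is cut into blocks of `T` consecutive heights, and its lowest block is merged into
one member of a cover of `X`. A ball then sees either only sets coming from that cover or at most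
two consecutive blocks of a single segment. -/
theorem asdimLE_attachSegments (hX : X.Connected) {n : ℕ} (hn : 1 ≤ n) (h : AsdimLE X n) :
    AsdimLE (attachSegments X x α) n := by
  intro R hR
  have hc := attachSegments_connected (x := x) (α := α) hX
  obtain ⟨𝒰, hcov, ⟨D, hD⟩, hmul⟩ := h R hR
  choose ch hch hmem using hcov
  obtain ⟨r, hr⟩ := exists_nat_ge R
  -- A ball centred at height at most `r` stays below height `T`, and a window of heights of radius
  -- `r` meets at most two blocks.
  obtain ⟨T, hT⟩ : ∃ T, T = 2 * r + 1 := ⟨_, rfl⟩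
  have hT0 : 0 < T := by omega
  -- The choice `ch` assigns each low block to a single member; mere membership of its base vertex
  -- in `U` would put the block into several.
  let ext : Set V → Set (V ⊕ SegVertex α) := fun U =>
    {a | segProj x a ∈ U ∧ ∀ p, a = Sum.inr p → p.1.2 < T ∧ ch (x ((p.1.1 : ℤ) ^ 2)) = U}
  let piece : ℕ × ℕ → Set (V ⊕ SegVertex α) := fun i =>
    {a | ∃ p : SegVertex α, a = Sum.inr p ∧ p.1.1 = i.1 ∧ p.1.2 / T = i.2}
  have hdist : ∀ c a : V ⊕ SegVertex α, ((attachSegments X x α).dist c a : ℝ) ≤ R →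
      (attachSegments X x α).dist c a ≤ r := fun c a hca => by
    exact_mod_cast hca.trans hr
  refine ⟨ext '' 𝒰 ∪ piece '' {i | 1 ≤ i.2}, ?_, ⟨D + 2 * T, ?_⟩, ?_⟩
  · rintro (a | p)
    · refine ⟨ext (ch a), Or.inl (Set.mem_image_of_mem _ (hch a)), hmem a, ?_⟩
      rintro p ⟨⟩
    · rcases Nat.lt_or_ge p.1.2 T with hp | hp
      · refine ⟨ext (ch (x ((p.1.1 : ℤ) ^ 2))), Or.inl (Set.mem_image_of_mem _ (hch _)),
          hmem _, ?_⟩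
        rintro q hq
        obtain rfl := Sum.inr_injective hq
        exact ⟨hp, rfl⟩
      · exact ⟨piece (p.1.1, p.1.2 / T), Or.inr (Set.mem_image_of_mem _
          ((Nat.one_le_div_iff hT0).2 hp)), p, rfl, rfl, rfl⟩
  · rintro _ (⟨U, hU, rfl⟩ | ⟨⟨m, j⟩, hj, rfl⟩)
    · have hbase : ∀ a ∈ ext U, (attachSegments X x α).dist a (Sum.inl (segProj x a)) ≤ T := by
        rintro (a | p) ha
        · simp
        · exact (dist_inr_segProj_le hX p).trans (ha.2 p rfl).1.le
      intro a ha b hb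
      have h1 := hbase a ha
      have h2 := hbase b hb
      rw [SimpleGraph.dist_comm] at h2
      have h3 := (dist_attach_inl_le (x := x) (α := α) hX _ _).trans (hD U hU _ ha.1 _ hb.1)
      have h4 := hc.dist_triangle (u := a) (v := Sum.inl (segProj x a)) (w := b)
      have h5 := hc.dist_triangle (u := Sum.inl (segProj x a)) (v := Sum.inl (segProj x b))
        (w := b)
      omega
    · have key : ∀ p q : SegVertex α, p.1.1 = q.1.1 → p.1.2 / T = q.1.2 / T → p.1.2 ≤ q.1.2 →
          (attachSegments X x α).dist (Sum.inr q) (Sum.inr p) ≤ D + 2 * T := by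
        intro p q h1 h2 h3
        have h4 := dist_inr_inr_le (x := x) hX (q.1.2 - p.1.2) p q h1 (by omega)
        have h5 := Nat.div_add_mod p.1.2 T
        have h6 := Nat.div_add_mod q.1.2 T
        have h7 := Nat.mod_lt q.1.2 hT0
        rw [h2] at h5
        omega
      rintro _ ⟨p, rfl, hp1, hp2⟩ _ ⟨q, rfl, hq1, hq2⟩
      rcases le_total p.1.2 q.1.2 with hle | hle
      · rw [SimpleGraph.dist_comm]
        exact key p q (hp1.trans hq1.symm) (hp2.trans hq2.symm) hle
      · exact key q p (hq1.trans hp1.symm) (hq2.trans hp2.symm) hle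
  · intro c
    -- If the centre is low, projecting reduces the count to the cover of `X`. Otherwise the ball
    -- does not leave the segment of `c`, and the count is at most `2 ≤ n + 1`.
    by_cases hcase : ∀ m, segHeight m c ≤ r
    · refine (Set.encard_le_encard ?_).trans
        ((Set.encard_image_le ext _).trans (hmul (segProj x c)))
      rintro _ ⟨⟨U, hU, rfl⟩ | ⟨⟨m, j⟩, hj, rfl⟩, a, ha, hca⟩
      · refine ⟨U, ⟨hU, segProj x a, ha.1, le_trans ?_ hca⟩, rfl⟩
        exact_mod_cast dist_segProj_le hX c a
      · exfalso
        obtain ⟨p, rfl, hp1, hp2⟩ := ha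
        have h1 := segHeight_le (x := x) hX m (Sum.inr p) c
        rw [SimpleGraph.dist_comm] at h1
        have h2 := hdist _ _ hca
        have h3 := hcase m
        have hj' : 1 ≤ j := hj
        have h4 : T ≤ p.1.2 := (Nat.one_le_div_iff hT0).1 (by
          simp only at hp2
          omega)
        simp only at hp1
        rw [segHeight_inr, if_pos hp1] at h1
        omega
    · push Not at hcase
      obtain ⟨m, hm⟩ := hcase
      rcases c with c | p
      · simp at hm
      rw [segHeight_inr] at hm
      split_ifs at hm with hpm
      · subst hpm
        -- The unique member of the cover containing the `j`-th block of this segment.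
        let E : ℕ → Set (V ⊕ SegVertex α) := fun j =>
          if j = 0 then ext (ch (x ((p.1.1 : ℤ) ^ 2))) else piece (p.1.1, j)
        have hsub : {U | U ∈ ext '' 𝒰 ∪ piece '' {i | 1 ≤ i.2} ∧
            ∃ a ∈ U, ((attachSegments X x α).dist (Sum.inr p) a : ℝ) ≤ R} ⊆
            {E ((p.1.2 - r) / T), E ((p.1.2 - r) / T + 1)} := by
          rintro U ⟨hU, a, ha, hca⟩
          have h2 := hdist _ _ hca
          have h1 := segHeight_le (x := x) hX p.1.1 (Sum.inr p) a
          have h3 := segHeight_le (x := x) hX p.1.1 a (Sum.inr p)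
          rw [SimpleGraph.dist_comm] at h3
          rw [segHeight_inr, if_pos rfl] at h1 h3
          rcases a with a | q
          · rw [segHeight_inl] at h1
            omega
          rw [segHeight_inr] at h1 h3
          split_ifs at h1 h3 with hq
          · have hE : U = E (q.1.2 / T) := by
              rcases hU with ⟨U, hU, rfl⟩ | ⟨⟨m, j⟩, hj, rfl⟩
              · obtain ⟨h4, h5⟩ := ha.2 q rfl
                simp only [E, Nat.div_eq_of_lt h4, if_true, ← h5, hq]
              · obtain ⟨q', hq', h4, h5⟩ := ha
                obtain rfl := Sum.inr_injective hq'
                simp only at h4 h5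
                have hj' : 1 ≤ j := hj
                simp only [E, h5, if_neg (show ¬ j = 0 by omega), ← h4, hq]
            have h4 : (p.1.2 - r) / T ≤ q.1.2 / T := Nat.div_le_div_right (by omega)
            have h5 : q.1.2 / T ≤ (p.1.2 - r + T) / T := Nat.div_le_div_right (by omega)
            rw [Nat.add_div_right _ hT0] at h5
            rcases Nat.lt_or_ge ((p.1.2 - r) / T) (q.1.2 / T) with h6 | h6
            · right
              rw [Set.mem_singleton_iff, hE]
              congr 1
              omega
            · left
              rw [hE]
              congr 1
              omega
          · omega
        refine (Set.encard_le_encard hsub).trans ((Set.encard_insert_le _ _).trans ?_)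
        rw [Set.encard_singleton]
        exact add_le_add (by exact_mod_cast hn) le_rfl
      · omega

theorem attachSegments_asdim (hX : X.Connected) (hx : IsGeodesicLine X x) :
    asdim (attachSegments X x α) = asdim X := by
  apply le_antisymm
  · refine asdim_le_of_forall fun n hn => asdimLE_attachSegments hX ?_ hn
    rcases Nat.eq_zero_or_pos n with rfl | h
    · refine absurd hn (not_asdimLE_zero hX fun D => ⟨x 0, x (D + 1 : ℕ), ?_⟩)
      have := hx 0 (D + 1 : ℕ)
      rw [zero_sub, abs_neg, Nat.abs_cast] at this
      omega
    · exact h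
  · refine asdim_le_of_forall fun n hn => hn.of_map Sum.inl 1 (fun a b => ?_) fun D =>
      ⟨D, fun a b hab => (dist_segProj_le (x := x) hX (Sum.inl a) (Sum.inl b)).trans hab⟩
    have := dist_attach_inl_le (x := x) (α := α) hX a b
    omega

end Attach

/-! ### Replacing bounded degree by degree three -/

section ThreeRegular

variable {V : Type*} {Z : SimpleGraph V} {M : ℕ} {e : V → V → ZMod M}

open Classical in
/-- The third neighbour of a vertex: slot `i` of the cycle at `v` is joined to the slot of the
neighbour `w` of `v` with `e v w = i`, and to the same slot of the twin cycle if there is no such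
neighbour. -/
noncomputable def slotFlip (Z : SimpleGraph V) (e : V → V → ZMod M) (p : V × Bool × ZMod M) :
    V × Bool × ZMod M :=
  if h : ∃ w, Z.Adj p.1 w ∧ e p.1 w = p.2.2 then (h.choose, p.2.1, e h.choose p.1)
  else (p.1, !p.2.1, p.2.2)

theorem slotFlip_of_adj (he : ∀ v, Set.InjOn (e v) (Z.neighborSet v)) {v w : V}
    (h : Z.Adj v w) (c : Bool) : slotFlip Z e (v, c, e v w) = (w, c, e w v) := by
  have hex : ∃ w', Z.Adj v w' ∧ e v w' = e v w := ⟨w, h, rfl⟩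
  have hw : hex.choose = w := he v hex.choose_spec.1 h hex.choose_spec.2
  unfold slotFlip
  rw [dif_pos hex, hw]

theorem slotFlip_of_not {p : V × Bool × ZMod M} (h : ¬ ∃ w, Z.Adj p.1 w ∧ e p.1 w = p.2.2) :
    slotFlip Z e p = (p.1, !p.2.1, p.2.2) := dif_neg h

theorem slotFlip_slotFlip (he : ∀ v, Set.InjOn (e v) (Z.neighborSet v))
    (p : V × Bool × ZMod M) : slotFlip Z e (slotFlip Z e p) = p := by
  obtain ⟨v, c, i⟩ := p
  by_cases h : ∃ w, Z.Adj v w ∧ e v w = i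
  · obtain ⟨w, hw, rfl⟩ := h
    rw [slotFlip_of_adj he hw, slotFlip_of_adj he hw.symm]
  · rw [slotFlip_of_not (p := (v, c, i)) h, slotFlip_of_not (p := (v, !c, i)) h]
    simp

theorem slotFlip_ne (he : ∀ v, Set.InjOn (e v) (Z.neighborSet v)) (v : V) (c : Bool)
    (i j : ZMod M) : slotFlip Z e (v, c, i) ≠ (v, c, j) := by
  by_cases h : ∃ w, Z.Adj v w ∧ e v w = i
  · obtain ⟨w, hw, rfl⟩ := h
    rw [slotFlip_of_adj he hw]
    intro h
    exact hw.ne (congrArg Prod.fst h).symm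
  · rw [slotFlip_of_not (p := (v, c, i)) h]
    intro h
    have : (!c) = c := congrArg (fun q => q.2.1) h
    simp at this

theorem slotFlip_proj (he : ∀ v, Set.InjOn (e v) (Z.neighborSet v)) (p : V × Bool × ZMod M) :
    p.1 = (slotFlip Z e p).1 ∨ Z.Adj p.1 (slotFlip Z e p).1 := by
  obtain ⟨v, c, i⟩ := p
  by_cases h : ∃ w, Z.Adj v w ∧ e v w = i
  · obtain ⟨w, hw, rfl⟩ := h
    rw [slotFlip_of_adj he hw]
    exact Or.inr hw
  · rw [slotFlip_of_not (p := (v, c, i)) h]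
    exact Or.inl rfl

/-- The graph obtained from `Z` by replacing every vertex by two `M`-cycles, joined to the cycles of
the neighbours and to each other according to `slotFlip`. -/
def cycleBlowup (Z : SimpleGraph V) (e : V → V → ZMod M) [Fact (1 < M)]
    (he : ∀ v, Set.InjOn (e v) (Z.neighborSet v)) : SimpleGraph (V × Bool × ZMod M) where
  Adj p q := (p.1 = q.1 ∧ p.2.1 = q.2.1 ∧ (q.2.2 = p.2.2 + 1 ∨ p.2.2 = q.2.2 + 1)) ∨
    q = slotFlip Z e p
  symm := ⟨by
    rintro p q (⟨h1, h2, h3⟩ | rfl)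
    · exact Or.inl ⟨h1.symm, h2.symm, h3.symm⟩
    · exact Or.inr (slotFlip_slotFlip he p).symm⟩
  loopless := ⟨by
    rintro ⟨v, c, i⟩ (⟨-, -, h⟩ | h)
    · simp at h
    · exact slotFlip_ne he v c i i h.symm⟩

variable [Fact (1 < M)] {he : ∀ v, Set.InjOn (e v) (Z.neighborSet v)}

/-- Two neighbours on the cycle, distinct because `M > 2`, and the partner under `slotFlip`, which
never lies on the same cycle. -/
theorem cycleBlowup_isThreeRegular (hM : 2 < M) : IsThreeRegular (cycleBlowup Z e he) := by
  rintro ⟨v, c, i⟩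
  have h2 : (2 : ZMod M) ≠ 0 := by
    have : ((2 : ℕ) : ZMod M) ≠ 0 := by
      rw [Ne, ZMod.natCast_eq_zero_iff]
      exact Nat.not_dvd_of_pos_of_lt (by norm_num) hM
    exact_mod_cast this
  have hset : (cycleBlowup Z e he).neighborSet (v, c, i) =
      {(v, c, i + 1), (v, c, i - 1), slotFlip Z e (v, c, i)} := by
    ext ⟨w, d, j⟩
    simp only [Set.mem_insert_iff, Set.mem_singleton_iff, SimpleGraph.mem_neighborSet]
    constructor
    · rintro (⟨h1, h2, h3 | h3⟩ | h)
      · obtain rfl : v = w := h1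
        obtain rfl : c = d := h2
        exact Or.inl (by rw [show j = i + 1 from h3])
      · obtain rfl : v = w := h1
        obtain rfl : c = d := h2
        exact Or.inr (Or.inl (by rw [show i = j + 1 from h3, add_sub_cancel_right]))
      · exact Or.inr (Or.inr h)
    · rintro (h | h | h)
      · rw [h]
        exact Or.inl ⟨rfl, rfl, Or.inl rfl⟩
      · rw [h]
        exact Or.inl ⟨rfl, rfl, Or.inr (by simp)⟩
      · exact Or.inr h
  rw [hset, Set.encard_eq_three]
  refine ⟨_, _, _, ?_, (slotFlip_ne he v c i _).symm, (slotFlip_ne he v c i _).symm, rfl⟩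
  intro h
  have h3 : i + 1 = i - 1 := congrArg (fun q => q.2.2) h
  exact h2 (by linear_combination h3)

theorem cycleBlowup_adj_succ (v : V) (c : Bool) (i : ZMod M) :
    (cycleBlowup Z e he).Adj (v, c, i) (v, c, i + 1) := Or.inl ⟨rfl, rfl, Or.inl rfl⟩

theorem cycleBlowup_adj_edge {v w : V} (h : Z.Adj v w) (c : Bool) :
    (cycleBlowup Z e he).Adj (v, c, e v w) (w, c, e w v) :=
  Or.inr (slotFlip_of_adj he h c).symm

/-- Slot `0` is kept free of edges of `Z`, so it always links the twin cycles; this makes the fibres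
connected with bounded diameter. -/
theorem cycleBlowup_adj_twin (h0 : ∀ v w, Z.Adj v w → e v w ≠ 0) (v : V) (c : Bool) :
    (cycleBlowup Z e he).Adj (v, c, 0) (v, !c, 0) :=
  Or.inr (slotFlip_of_not (p := (v, c, 0)) fun ⟨w, hw, h⟩ => h0 v w hw h).symm

theorem cycleBlowup_exists_walk_add (v : V) (c : Bool) (i : ZMod M) (k : ℕ) :
    ∃ p : (cycleBlowup Z e he).Walk (v, c, i) (v, c, i + k), p.length = k := by
  induction k with
  | zero => exact ⟨SimpleGraph.Walk.nil.copy rfl (by simp), by simp⟩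
  | succ k ih =>
    obtain ⟨p, hp⟩ := ih
    exact ⟨(p.concat (cycleBlowup_adj_succ v c _)).copy rfl (by push_cast; rw [add_assoc]),
      by simp [hp]⟩

theorem cycleBlowup_exists_walk (v : V) (c : Bool) (i j : ZMod M) :
    ∃ p : (cycleBlowup Z e he).Walk (v, c, i) (v, c, j), p.length ≤ M := by
  have : NeZero M := ⟨by have := (Fact.out : 1 < M); omega⟩
  obtain ⟨p, hp⟩ := cycleBlowup_exists_walk_add (Z := Z) (he := he) v c i (j - i).val
  refine ⟨p.copy rfl (by rw [ZMod.natCast_val, ZMod.cast_id', id, add_sub_cancel]), ?_⟩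
  rw [SimpleGraph.Walk.length_copy, hp]
  exact (ZMod.val_lt _).le

theorem cycleBlowup_exists_walk_fiber (h0 : ∀ v w, Z.Adj v w → e v w ≠ 0) (v : V)
    (c d : Bool) (i j : ZMod M) :
    ∃ p : (cycleBlowup Z e he).Walk (v, c, i) (v, d, j), p.length ≤ 2 * M + 1 := by
  rcases eq_or_ne d c with rfl | h
  · obtain ⟨p, hp⟩ := cycleBlowup_exists_walk (Z := Z) (he := he) v d i j
    exact ⟨p, by omega⟩
  · obtain rfl : d = !c := by revert h; cases c <;> cases d <;> simp
    obtain ⟨p, hp⟩ := cycleBlowup_exists_walk (Z := Z) (he := he) v c i 0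
    obtain ⟨q, hq⟩ := cycleBlowup_exists_walk (Z := Z) (he := he) v (!c) 0 j
    refine ⟨p.append (SimpleGraph.Walk.cons (cycleBlowup_adj_twin h0 v c) q), ?_⟩
    rw [SimpleGraph.Walk.length_append, SimpleGraph.Walk.length_cons]
    omega

theorem cycleBlowup_exists_walk_adj (h0 : ∀ v w, Z.Adj v w → e v w ≠ 0) {v w : V}
    (h : Z.Adj v w) (c d : Bool) (i j : ZMod M) :
    ∃ p : (cycleBlowup Z e he).Walk (v, c, i) (w, d, j), p.length ≤ 4 * M + 3 := by
  obtain ⟨p, hp⟩ := cycleBlowup_exists_walk_fiber (he := he) h0 v c c i (e v w)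
  obtain ⟨q, hq⟩ := cycleBlowup_exists_walk_fiber (he := he) h0 w c d (e w v) j
  refine ⟨p.append (SimpleGraph.Walk.cons (cycleBlowup_adj_edge h c) q), ?_⟩
  rw [SimpleGraph.Walk.length_append, SimpleGraph.Walk.length_cons]
  omega

theorem cycleBlowup_connected (hZ : Z.Connected) (h0 : ∀ v w, Z.Adj v w → e v w ≠ 0) :
    (cycleBlowup Z e he).Connected := by
  obtain ⟨o⟩ := hZ.nonempty
  have : Nonempty (V × Bool × ZMod M) := ⟨(o, true, 0)⟩
  refine ⟨?_⟩
  rintro ⟨v, c, i⟩ ⟨w, d, j⟩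
  have hr := hZ.preconnected v w
  rw [SimpleGraph.reachable_iff_reflTransGen] at hr
  induction hr generalizing d j with
  | refl =>
    obtain ⟨p, -⟩ := cycleBlowup_exists_walk_fiber (he := he) h0 v c d i j
    exact p.reachable
  | @tail b w _ h ih =>
    obtain ⟨p, -⟩ := cycleBlowup_exists_walk_adj (he := he) h0 h c d i j
    exact (ih c i).trans p.reachable

theorem cycleBlowup_isCoarseInverse (hZ : Z.Connected) (h0 : ∀ v w, Z.Adj v w → e v w ≠ 0) :
    IsCoarseInverse (cycleBlowup Z e he) Z Prod.fst (fun v => (v, true, 0)) (4 * M + 3) := by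
  have hc := cycleBlowup_connected (he := he) hZ h0
  refine ⟨fun a b => ?_, fun a b => ?_, ?_, fun b => by simp⟩
  · have := dist_le_of_adj hc hZ (f := Prod.fst) (K := 1) (fun p q hpq => by
      rcases hpq with ⟨h, -, -⟩ | rfl
      · simp [h]
      · rcases slotFlip_proj he p with h | h
        · simp [← h]
        · exact (SimpleGraph.dist_eq_one_iff_adj.2 h).le) a b
    nlinarith
  · have := dist_le_of_adj hZ hc (f := fun v => (v, true, (0 : ZMod M))) (K := 4 * M + 3)
      (fun v w hvw => by
        obtain ⟨p, hp⟩ := cycleBlowup_exists_walk_adj (he := he) h0 hvw true true 0 0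
        exact (SimpleGraph.dist_le p).trans hp) a b
    omega
  · rintro ⟨v, c, i⟩
    obtain ⟨p, hp⟩ := cycleBlowup_exists_walk_fiber (he := he) h0 v true c 0 i
    exact (SimpleGraph.dist_le p).trans (hp.trans (by omega))

end ThreeRegular

/-- With `Δ + 3` slots, enough nonzero ones remain for all neighbours, and the cycles have length at
least three. -/
theorem exists_slots {V : Type*} {Z : SimpleGraph V} {Δ : ℕ}
    (hΔ : ∀ a, (Z.neighborSet a).encard ≤ Δ) :
    ∃ e : V → V → ZMod (Δ + 3), (∀ v, Set.InjOn (e v) (Z.neighborSet v)) ∧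
      ∀ v w, Z.Adj v w → e v w ≠ 0 := by
  have key : ∀ v, ∃ f : V → ZMod (Δ + 3), Z.neighborSet v ⊆ f ⁻¹' {i | i ≠ 0} ∧
      Set.InjOn f (Z.neighborSet v) := fun v => by
    refine Set.Finite.exists_injOn_of_encard_le (isLocallyFinite_of_encard_le hΔ v)
      ((hΔ v).trans ?_)
    have h1 : ({i : ZMod (Δ + 3) | i ≠ 0}).ncard = Δ + 2 := by
      have h2 := Set.ncard_compl ({0} : Set (ZMod (Δ + 3)))
      rw [Set.ncard_singleton, Nat.card_eq_fintype_card, ZMod.card] at h2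
      exact h2
    rw [← (Set.toFinite _).cast_ncard_eq, h1]
    exact_mod_cast Nat.le_add_right Δ 2
  choose e he using key
  exact ⟨e, fun v => (he v).2, fun v w h => (he v).1 h⟩

/-- An infinite connected graph of bounded degree is coarsely equivalent to a connected `3`-regular
graph, through maps with bounded fibres. -/
theorem exists_threeRegular {V : Type*} [Infinite V] {Z : SimpleGraph V} (hZ : Z.Connected)
    {Δ : ℕ} (hΔ : ∀ a, (Z.neighborSet a).encard ≤ Δ) :
    ∃ Y : SimpleGraph ℕ, Y.Connected ∧ IsThreeRegular Y ∧ CoarseEquiv Y Z ∧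
      SameGrowthRate Y Z := by
  obtain ⟨e, he, h0⟩ := exists_slots hΔ
  have : Fact (1 < Δ + 3) := ⟨by omega⟩
  have hlZ := isLocallyFinite_of_encard_le hΔ
  have := countable_of_locallyFinite hZ hlZ
  -- The blow-up is countably infinite, so it can be transported to `ℕ`, giving all graphs of the
  -- family the same vertex set.
  obtain ⟨ε⟩ := nonempty_equiv_of_countable (α := ℕ) (β := V × Bool × ZMod (Δ + 3))
  let B := cycleBlowup Z e he
  have hB : B.Connected := cycleBlowup_connected hZ h0
  have hBi := cycleBlowup_isCoarseInverse (he := he) hZ h0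
  let φ : B.comap ε ≃g B := SimpleGraph.Iso.comap ε B
  have hφ : ∀ a b, B.dist (ε a) (ε b) = (B.comap ε).dist a b := dist_iso φ
  have hYc : (B.comap ε).Connected := φ.connected_iff.2 hB
  have hY3 : IsThreeRegular (B.comap ε) := fun a => by
    rw [← cycleBlowup_isThreeRegular (he := he) (by omega) (ε a),
      ← Function.Injective.encard_image ε.injective]
    congr 1
    ext b
    obtain ⟨b, rfl⟩ := ε.surjective b
    rw [ε.injective.mem_set_image]
    rfl
  have hYi : IsCoarseInverse (B.comap ε) Z (fun n => (ε n).1) (fun v => ε.symm (v, true, 0))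
      (4 * (Δ + 3) + 3) := by
    refine ⟨fun a b => ?_, fun a b => ?_, fun a => ?_, fun b => by simp⟩
    · rw [← hφ]
      exact hBi.dist_left _ _
    · rw [← hφ, ε.apply_symm_apply, ε.apply_symm_apply]
      exact hBi.dist_right _ _
    · rw [← hφ, ε.apply_symm_apply]
      exact hBi.left_inv _
  refine ⟨B.comap ε, hYc, hY3, ⟨_, _, _, hYi⟩, fun a b => ⟨?_, ?_⟩⟩
  · refine growthLE_of_map hZ hlZ _ _ (2 * (Δ + 3)) hYi.dist_left (fun v => ?_) _ _
    have h1 : {n | (ε n).1 = v}.encard ≤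
        (Set.univ : Set (Bool × ZMod (Δ + 3))).encard := by
      refine Set.encard_le_encard_of_injOn (f := fun n => (ε n).2) (fun _ _ => Set.mem_univ _) ?_
      intro m hm n hn hmn
      exact ε.injective (Prod.ext (Eq.trans hm (Eq.symm hn)) hmn)
    refine h1.trans ?_
    rw [Set.encard_univ, ENat.card_eq_coe_fintype_card]
    simp [ZMod.card]
  · refine growthLE_of_map hYc (isLocallyFinite_of_encard_le (Δ := 3) fun a => (hY3 a).le) _ _ 1
      hYi.dist_right (fun n => ?_) _ _
    rw [Nat.cast_one, Set.encard_le_one_iff]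
    intro v w hv hw
    have h1 : ε.symm (v, true, 0) = ε.symm (w, true, 0) := Eq.trans hv (Eq.symm hw)
    exact congrArg Prod.fst (ε.symm.injective h1)

/-! ### Distinguishing the exponents -/

section NotQuasiIsometric

theorem segLength_mono {α : ℝ} (h0 : 0 < α) {m n : ℕ} (hm : 1 ≤ m) (hmn : m ≤ n) :
    segLength α m ≤ segLength α n := by
  have hm' : (1 : ℝ) ≤ m := by exact_mod_cast hm
  refine Nat.ceil_mono (Real.rpow_le_rpow (Real.log_nonneg hm') ?_ h0.le)
  exact Real.log_le_log (by linarith) (by exact_mod_cast hmn)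

/-- Lengths `(log n) ^ β` are not linearly bounded by lengths `(log (c n)) ^ α` if `α < β`. -/
theorem not_forall_segLength_le {α β : ℝ} (h0 : 0 < α) (h1 : α ≤ 1) (hαβ : α < β) (A c : ℕ)
    (hc : 1 ≤ c) : ¬ ∀ n, 1 ≤ n → segLength β n ≤ A + A * segLength α (c * n) := by
  intro h
  have hlog : Filter.Tendsto (fun n : ℕ => Real.log (n : ℝ)) Filter.atTop Filter.atTop :=
    Real.tendsto_log_atTop.comp tendsto_natCast_atTop_atTop
  have hpow := (tendsto_rpow_atTop (sub_pos.2 hαβ)).comp hlog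
  -- With `t = log n`, the assumed bound gives `t ^ β ≤ 2 * A + 2 * A * t ^ α ≤ 4 * A * t ^ α`, so
  -- `t ^ (β - α) > 4 * A` is the contradiction to aim for.
  obtain ⟨n, hn1, hn2, hn3, hn4⟩ := ((Filter.eventually_ge_atTop 1).and
    ((hlog.eventually_ge_atTop 1).and ((hlog.eventually_ge_atTop (Real.log c)).and
    (hpow.eventually_gt_atTop (4 * (A : ℝ)))))).exists
  have hn0 : (0 : ℝ) < n := by exact_mod_cast hn1
  have hc0 : (0 : ℝ) < c := by exact_mod_cast hc
  have hc1 : (1 : ℝ) ≤ c := by exact_mod_cast hc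
  set t := Real.log (n : ℝ) with ht
  have ht0 : 0 < t := by linarith
  have h2 : t ^ β ≤ segLength β n := Nat.le_ceil _
  have h3 : (segLength α (c * n) : ℝ) ≤ 2 * t ^ α + 1 := by
    have h4 : (segLength α (c * n) : ℝ) < Real.log ((c * n : ℕ) : ℝ) ^ α + 1 := by
      refine Nat.ceil_lt_add_one (Real.rpow_nonneg (Real.log_nonneg ?_) _)
      exact_mod_cast Nat.mul_pos hc hn1
    have h5 : Real.log ((c * n : ℕ) : ℝ) ≤ 2 * t := by
      rw [Nat.cast_mul, Real.log_mul hc0.ne' hn0.ne']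
      linarith
    have h6 : Real.log ((c * n : ℕ) : ℝ) ^ α ≤ (2 * t) ^ α := by
      refine Real.rpow_le_rpow (Real.log_nonneg ?_) h5 h0.le
      exact_mod_cast Nat.mul_pos hc hn1
    have h7 : (2 * t) ^ α ≤ 2 * t ^ α := by
      rw [Real.mul_rpow (by norm_num) ht0.le]
      refine mul_le_mul_of_nonneg_right ?_ (Real.rpow_nonneg ht0.le _)
      calc (2 : ℝ) ^ α ≤ 2 ^ (1 : ℝ) := Real.rpow_le_rpow_of_exponent_le (by norm_num) h1
        _ = 2 := Real.rpow_one _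
    linarith
  have h8 : (segLength β n : ℝ) ≤ A + A * segLength α (c * n) := by exact_mod_cast h n hn1
  have h9 : t ^ β = t ^ (β - α) * t ^ α := by
    rw [← Real.rpow_add ht0, sub_add_cancel]
  have h10 : 1 ≤ t ^ α := Real.one_le_rpow hn2 h0.le
  have h11 : 4 * (A : ℝ) * t ^ α < t ^ (β - α) * t ^ α :=
    mul_lt_mul_of_pos_right hn4 (by linarith)
  have hA : (0 : ℝ) ≤ A := Nat.cast_nonneg A
  nlinarith [mul_le_mul_of_nonneg_left h3 hA, mul_le_mul_of_nonneg_left h10 hA]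

variable {V : Type*} {X : SimpleGraph V} {x : ℤ → V} {α β : ℝ}

/-- The finite components of the complement of a ball of radius `r` in `X_α` project to vertices of
`X` at bounded distance from the projection of the centre. -/
theorem exists_dist_segProj_le_of_finite_component (hl : IsLocallyFinite X) (hX : X.Connected)
    (ht : IsVertexTransitive X) (x : ℤ → V) (α : ℝ) (r : ℕ) :
    ∃ D : ℕ, ∀ q c : V ⊕ SegVertex α,
      {d | ReachOff (attachSegments X x α) {a | (attachSegments X x α).dist q a ≤ r} c d}.Finite →
      X.dist (segProj x q) (segProj x c) ≤ D := by
  obtain ⟨D, hD⟩ := exists_dist_le_of_finite_component hl hX ht r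
  refine ⟨max r D, fun q c hfin => ?_⟩
  rcases Nat.lt_or_ge r (X.dist (segProj x q) (segProj x c)) with h | h
  · refine le_max_of_le_right (hD _ _ ?_)
    let B : Set (V ⊕ SegVertex α) := {a | X.dist (segProj x q) (segProj x a) ≤ r}
    have hB : {a | (attachSegments X x α).dist q a ≤ r} ⊆ B := fun a ha =>
      (dist_segProj_le hX q a).trans ha
    have h1 : ReachOff (attachSegments X x α) B c (Sum.inl (segProj x c)) :=
      reachOff_segProj B c fun b hb hbB => by
        have h2 : X.dist (segProj x q) (segProj x b) ≤ r := hbB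
        rw [hb] at h2
        omega
    refine Set.Finite.of_injOn (f := Sum.inl) (fun d hd => ?_) Sum.inl_injective.injOn hfin
    refine ReachOff.mono hB (h1.trans (ReachOff.lift Sum.inl (fun a b hab ha hb => ?_) hd))
    exact ReachOff.single hab ha hb
  · exact le_max_of_le_left h

/-- A quasi-isometry maps a finite component of the complement of a vertex into a finite component
of the complement of a ball. -/
theorem IsCoarseInverse.finite_component {W W' : Type*} {G : SimpleGraph W} {H : SimpleGraph W'}
    (hG : G.Connected) (hH : H.Connected) (hl : IsLocallyFinite H) {f : W → W'} {g : W' → W}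
    {K : ℕ} (h : IsCoarseInverse G H f g K) {p t : W} (hpt : K < G.dist t p)
    (hfin : {d | ReachOff G {p} t d}.Finite) :
    {d | ReachOff H {a | H.dist (f p) a ≤ K * (2 * K) + 2 * K} (f t) d}.Finite := by
  refine (hfin.biUnion fun w _ => h.symm.finite_fiber hH hl w).subset fun d hd => ?_
  refine Set.mem_biUnion (x := g d) ?_ rfl
  -- As `t` is farther than `K` from `p`, the short path from `t` to `g (f t)` misses `p`; hence `g`
  -- takes the component of `f t` into the finite component of `t`.
  have h1 : ReachOff G {p} t (g (f t)) := by
    refine reachOff_of_forall_dist hG K ?_ fun c hc hcp => ?_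
    · rw [SimpleGraph.dist_comm]
      exact h.left_inv t
    · obtain rfl : c = p := hcp
      omega
  refine h1.trans (ReachOff.lift g (fun a b hab ha _ => ?_) hd)
  -- If `p` were within `2 * K` of `g a`, then `f p` would be within `K * (2 * K) + K` of `f (g a)`,
  -- hence within the radius of the removed ball from `a`.
  refine reachOff_of_forall_dist hG (2 * K) ?_ fun c hc hcp => ha ?_
  · have := h.dist_right a b
    rw [SimpleGraph.dist_eq_one_iff_adj.2 hab] at this
    omega
  · obtain rfl : c = p := hcp
    have h2 := h.dist_left c (g a)
    rw [SimpleGraph.dist_comm (u := c)] at h2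
    have h3 := Nat.mul_le_mul_left K hc
    have h4 := hH.dist_triangle (u := f c) (v := f (g a)) (w := a)
    have h5 := h.right_inv a
    show H.dist (f c) a ≤ _
    omega

theorem finite_segment_component (h0 : 0 < α) (h1 : α ≤ 1) (p : SegVertex α) :
    {d | ReachOff (attachSegments X x α) {Sum.inl (x ((p.1.1 : ℤ) ^ 2))} (Sum.inr p) d}.Finite := by
  refine ((finite_segVertex_le h0 h1 p.1.1).image Sum.inr).subset fun d hd => ?_
  have key : ∃ q : SegVertex α, d = Sum.inr q ∧ q.1.1 = p.1.1 := by
    induction hd with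
    | refl => exact ⟨p, rfl, rfl⟩
    | @tail b d _ h ih =>
      obtain ⟨q, rfl, hq⟩ := ih
      obtain ⟨h1, -, h2⟩ := h
      rcases d with a | q'
      · have h3 : a = x ((q.1.1 : ℤ) ^ 2) := h1.1
        rw [hq] at h3
        exact absurd (congrArg Sum.inl h3) h2
      · exact ⟨q', rfl, h1.1.symm.trans hq⟩
  obtain ⟨q, rfl, hq⟩ := key
  exact Set.mem_image_of_mem _ hq.le

/-- A segment based within `N ^ 2` of `x 0` has index at most `N`, and lengths increase with the
index. -/
theorem dist_segProj_le_segLength (hX : X.Connected) (hx : IsGeodesicLine X x) (h0 : 0 < α)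
    (a : V ⊕ SegVertex α) {N : ℕ} (hN : X.dist (x 0) (segProj x a) ≤ N ^ 2) :
    (attachSegments X x α).dist a (Sum.inl (segProj x a)) ≤ segLength α N := by
  rcases a with a | p
  · simp
  · rw [segProj_inr, sq_eq_dist hx] at hN
    refine (dist_inr_segProj_le hX p).trans (p.2.2.2.trans (segLength_mono h0 p.2.1 ?_))
    exact (Nat.pow_le_pow_iff_left (by norm_num)).1 hN

theorem not_coarseEquiv_attachSegments (hl : IsLocallyFinite X) (hX : X.Connected)
    (ht : IsVertexTransitive X) (hx : IsGeodesicLine X x) (h0 : 0 < α) (hαβ : α < β)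
    (hβ : β ≤ 1) (hlα : IsLocallyFinite (attachSegments X x α)) :
    ¬ CoarseEquiv (attachSegments X x β) (attachSegments X x α) := by
  rintro ⟨f, g, K, h⟩
  have hα := attachSegments_connected (x := x) (α := α) hX
  have hβc := attachSegments_connected (x := x) (α := β) hX
  obtain ⟨D, hD⟩ := exists_dist_segProj_le_of_finite_component hl hX ht x α
    (K * (2 * K) + 2 * K)
  obtain ⟨C, hC⟩ : ∃ C, C = X.dist (x 0) (segProj x (f (Sum.inl (x 0)))) := ⟨_, rfl⟩
  -- Makes `(E * n) ^ 2` exceed the distance from `x 0` to the projections of both images, so the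
  -- segments they may lie on have index at most `E * n`.
  obtain ⟨E, hE⟩ : ∃ E, E = C + 2 * K + D + 1 := ⟨_, rfl⟩
  refine not_forall_segLength_le h0 (hαβ.le.trans hβ) hαβ (K * D + 4 * K) E (by omega)
    fun n hn => ?_
  -- Short segments satisfy the bound trivially; on the others the tip is far enough from the base
  -- for `IsCoarseInverse.finite_component`.
  rcases Nat.lt_or_ge K (segLength β n) with hK | hK
  swap
  · have := Nat.zero_le (K * D)
    have := Nat.zero_le ((K * D + 4 * K) * segLength α (E * n))
    omega
  let q : SegVertex β := ⟨(n, segLength β n), hn, by dsimp only; omega, le_rfl⟩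
  let p : V ⊕ SegVertex β := Sum.inl (x ((n : ℤ) ^ 2))
  have h1 : segLength β n ≤ (attachSegments X x β).dist (Sum.inr q) p := by
    have := segHeight_le (x := x) hX n (Sum.inr q) p
    rwa [segHeight_inr, if_pos rfl, segHeight_inl, zero_add] at this
  have h2 : X.dist (segProj x (f p)) (segProj x (f (Sum.inr q))) ≤ D :=
    hD _ _ (h.finite_component hβc hα hlα (hK.trans_le h1)
      (finite_segment_component (h0.trans hαβ) hβ q))
  have h3 : X.dist (x 0) (segProj x (f p)) ≤ C + (K * n ^ 2 + K) := by
    have h4 := h.dist_left (Sum.inl (x 0)) p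
    have h5 : K * (attachSegments X x β).dist (Sum.inl (x 0)) p ≤ K * n ^ 2 :=
      Nat.mul_le_mul_left K ((dist_attach_inl_le (x := x) (α := β) hX (x 0) (x ((n : ℤ) ^ 2))).trans
        (sq_eq_dist hx n).le)
    have h6 := dist_segProj_le (x := x) hX (f (Sum.inl (x 0))) (f p)
    have h7 := hX.dist_triangle (u := x 0) (v := segProj x (f (Sum.inl (x 0))))
      (w := segProj x (f p))
    omega
  have hsq : C + (K * n ^ 2 + K) + D ≤ (E * n) ^ 2 := by
    have hn2 : 1 ≤ n ^ 2 := Nat.one_le_pow _ _ hn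
    have h5 : C + (K * n ^ 2 + K) + D ≤ E * n ^ 2 := by
      rw [hE]
      nlinarith [Nat.mul_le_mul_left (C + K + D) hn2]
    refine h5.trans ?_
    rw [mul_pow]
    exact Nat.mul_le_mul_right _ (Nat.le_self_pow (by norm_num) E)
  have h8 := dist_segProj_le_segLength hX hx h0 (f p) (N := E * n) (by omega)
  have h9 := dist_segProj_le_segLength hX hx h0 (f (Sum.inr q)) (N := E * n) (by
    have := hX.dist_triangle (u := x 0) (v := segProj x (f p)) (w := segProj x (f (Sum.inr q)))
    omega)
  rw [SimpleGraph.dist_comm] at h9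
  have h10 : (attachSegments X x α).dist (f p) (f (Sum.inr q)) ≤
      2 * segLength α (E * n) + D := by
    have h11 := hα.dist_triangle (u := f p) (v := Sum.inl (segProj x (f p)))
      (w := f (Sum.inr q))
    have h12 := hα.dist_triangle (u := Sum.inl (segProj x (f p)))
      (v := Sum.inl (segProj x (f (Sum.inr q)))) (w := f (Sum.inr q))
    have h13 := (dist_attach_inl_le (x := x) (α := α) hX _ _).trans h2
    omega
  have h14 := h.dist_le hβc p (Sum.inr q)
  rw [SimpleGraph.dist_comm] at h14
  have h15 := Nat.mul_le_mul_left K h10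
  nlinarith [Nat.zero_le (K * D * segLength α (E * n)), Nat.zero_le (K * segLength α (E * n))]

end NotQuasiIsometric

/-- For every bi-infinite geodesic of `X`, the graphs `X_α` are coarsely equivalent to pairwise
non-quasi-isometric connected `3`-regular graphs with the coarse invariants of `X`. -/
theorem exists_threeRegular_family {V : Type*} [Infinite V] {X : SimpleGraph V}
    (hl : IsLocallyFinite X) (hX : X.Connected) (ht : IsVertexTransitive X) {x : ℤ → V}
    (hx : IsGeodesicLine X x) :
    ∃ Y : Set.Ioc (0 : ℝ) 1 → SimpleGraph ℕ,
      (∀ α, (Y α).Connected ∧ IsThreeRegular (Y α) ∧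
        (attachSegments X x α).Connected ∧
        QuasiIsometric (Y α) (attachSegments X x α) ∧
        SameGrowthRate (Y α) X ∧ numEnds (Y α) = numEnds X ∧ asdim (Y α) = asdim X) ∧
      ∀ α β, α ≠ β → ¬ QuasiIsometric (Y α) (Y β) := by
  obtain ⟨Δ, hΔ⟩ := exists_encard_neighborSet_le hX hl ht
  have hlα : ∀ α, IsLocallyFinite (attachSegments X x α) := fun α =>
    isLocallyFinite_of_encard_le (attach_encard_neighborSet_le hx hΔ)
  have hc : ∀ α, (attachSegments X x α).Connected := fun α => attachSegments_connected hX
  have key : ∀ α : Set.Ioc (0 : ℝ) 1, ∃ Y : SimpleGraph ℕ, Y.Connected ∧ IsThreeRegular Y ∧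
      CoarseEquiv Y (attachSegments X x α) ∧ SameGrowthRate Y (attachSegments X x α) := fun α =>
    have : Infinite (V ⊕ SegVertex (α : ℝ)) := Sum.infinite_of_left
    exists_threeRegular (hc α) (attach_encard_neighborSet_le hx hΔ)
  choose Y hYc hY3 hYe hYg using key
  have hlY : ∀ α, IsLocallyFinite (Y α) := fun α =>
    isLocallyFinite_of_encard_le (Δ := 3) fun a => (hY3 α a).le
  refine ⟨Y, fun α => ⟨hYc α, hY3 α, hc α, (hYe α).quasiIsometric (hYc α), ?_, ?_, ?_⟩, ?_⟩
  · exact (hYg α).trans (hYc α) (hlY α) (hc α) hX hl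
      (attachSegments_sameGrowthRate hX hl hx α.2.1 α.2.2 (hlα α))
  · exact ((hYe α).numEnds_eq (hYc α) (hlY α) (hc α) (hlα α)).trans
      (attachSegments_numEnds hX hl hx α.2.1 α.2.2 (hlα α))
  · exact ((hYe α).asdim_eq (hYc α) (hc α)).trans (attachSegments_asdim hX hx)
  · intro α β hne hq
    have h1 := QuasiIsometric.coarseEquiv (hYc β) hq
    have h2 : CoarseEquiv (attachSegments X x α) (attachSegments X x β) :=
      ((hYe α).symm.trans (hc α) (hYc β) h1).trans (hc α) (hc β) (hYe β)
    rcases lt_or_gt_of_ne (fun h => hne (Subtype.ext h) : (α : ℝ) ≠ β) with h | h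
    · exact not_coarseEquiv_attachSegments hl hX ht hx α.2.1 h β.2.2 (hlα α) h2.symm
    · exact not_coarseEquiv_attachSegments hl hX ht hx β.2.1 h α.2.2 (hlα β) h2

/-! ### Polynomial growth of nilpotent groups by commutator collection -/

section Collection

variable {G : Type*} [Group G]

/-- The product of a word in weighted letters. -/
def wordProd (l : List (G × ℕ)) : G := (l.map Prod.fst).prod

@[simp] theorem wordProd_nil : wordProd ([] : List (G × ℕ)) = 1 := rfl

@[simp] theorem wordProd_cons (a : G × ℕ) (l : List (G × ℕ)) :
    wordProd (a :: l) = a.1 * wordProd l := by simp [wordProd]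

@[simp] theorem wordProd_append (l m : List (G × ℕ)) :
    wordProd (l ++ m) = wordProd l * wordProd m := by simp [wordProd]

/-- The number of letters of weight `w`. -/
def weightCount (w : ℕ) (l : List (G × ℕ)) : ℕ := l.countP fun a => a.2 = w

/-- The commutators of the letters in `A` with the letters of at most the same weight are trivial or
letters in `A` of the next weight. -/
def IsCommClosed (A : Set (G × ℕ)) : Prop :=
  ∀ a ∈ A, ∀ b ∈ A, b.2 ≤ a.2 →
    a.1⁻¹ * b.1⁻¹ * a.1 * b.1 = 1 ∨ (a.1⁻¹ * b.1⁻¹ * a.1 * b.1, a.2 + 1) ∈ A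

/-- From `a * t = t * a * [a, t]`, with `[a, t] = a⁻¹ * t⁻¹ * a * t`: each letter that `t` passes
creates at most one new letter, of weight one higher. -/
theorem exists_move_left {B : Set (G × ℕ)} {t : G}
    (hB : ∀ a ∈ B, a.1⁻¹ * t⁻¹ * a.1 * t = 1 ∨ (a.1⁻¹ * t⁻¹ * a.1 * t, a.2 + 1) ∈ B)
    (l : List (G × ℕ)) (hl : ∀ a ∈ l, a ∈ B) :
    ∃ l' : List (G × ℕ), (∀ a ∈ l', a ∈ B) ∧ wordProd l * t = t * wordProd l' ∧
      weightCount 0 l' ≤ weightCount 0 l ∧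
      ∀ w, weightCount (w + 1) l' ≤ weightCount (w + 1) l + weightCount w l := by
  induction l with
  | nil => exact ⟨[], by simp, by simp, le_rfl, fun w => Nat.le_add_right _ _⟩
  | cons a l ih =>
    obtain ⟨l', h1, h2, h3, h4⟩ := ih fun b hb => hl b (List.mem_cons_of_mem _ hb)
    have ha := hl a List.mem_cons_self
    rcases hB a ha with hc | hc
    · refine ⟨a :: l', ?_, ?_, ?_, fun w => ?_⟩
      · exact List.forall_mem_cons.2 ⟨ha, h1⟩
      · rw [wordProd_cons, wordProd_cons, mul_assoc, h2]
        have : a.1 * t = t * a.1 := by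
          calc a.1 * t = t * a.1 * (a.1⁻¹ * t⁻¹ * a.1 * t) := by group
            _ = t * a.1 := by rw [hc, mul_one]
        rw [← mul_assoc, this, mul_assoc]
      · simp only [weightCount, List.countP_cons] at h3 ⊢
        omega
      · have := h4 w
        simp only [weightCount, List.countP_cons] at this ⊢
        omega
    · refine ⟨a :: (a.1⁻¹ * t⁻¹ * a.1 * t, a.2 + 1) :: l', ?_, ?_, ?_, fun w => ?_⟩
      · exact List.forall_mem_cons.2 ⟨ha, List.forall_mem_cons.2 ⟨hc, h1⟩⟩
      · rw [wordProd_cons, wordProd_cons, wordProd_cons, mul_assoc, h2]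
        group
      · simp only [weightCount, List.countP_cons] at h3 ⊢
        simpa using h3
      · have := h4 w
        simp only [weightCount, List.countP_cons, Nat.add_right_cancel_iff] at this ⊢
        omega

/-- All occurrences of a letter `t` of least weight are moved to the front, reading the word from
left to right. Commutators with `t` have larger weight than `t`, so no new `t` appears. The counts
follow from `n ^ (w + 2) + n ^ (w + 1) ≤ (n + 1) ^ (w + 2)`. -/
theorem exists_collect {A : Set (G × ℕ)} (hA : IsCommClosed A) {t : G × ℕ} (ht : t ∈ A)
    (hmin : ∀ a ∈ A, t.2 ≤ a.2) (l : List (G × ℕ)) (hl : ∀ a ∈ l, a ∈ A) :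
    ∃ k ≤ l.length, ∃ l' : List (G × ℕ), (∀ a ∈ l', a ∈ A \ {t}) ∧
      wordProd l = t.1 ^ k * wordProd l' ∧ ∀ w, weightCount w l' ≤ l.length ^ (w + 1) := by
  have hB : ∀ a ∈ A \ {t}, a.1⁻¹ * t.1⁻¹ * a.1 * t.1 = 1 ∨
      (a.1⁻¹ * t.1⁻¹ * a.1 * t.1, a.2 + 1) ∈ A \ {t} := by
    intro a ha
    refine (hA a ha.1 t ht (hmin a ha.1)).imp_right fun h => ⟨h, fun h' => ?_⟩
    have h1 : a.2 + 1 = t.2 := congrArg Prod.snd h'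
    have h2 := hmin a ha.1
    omega
  induction l using List.reverseRecOn with
  | nil => exact ⟨0, le_rfl, [], by simp, by simp, by simp [weightCount]⟩
  | append_singleton l a ih =>
    obtain ⟨k, hk, l', h1, h2, h3⟩ := ih fun b hb => hl b (by simp [hb])
    rw [List.length_append, List.length_singleton]
    by_cases hat : a = t
    · subst hat
      obtain ⟨l'', h4, h5, h6, h7⟩ := exists_move_left hB l' h1
      refine ⟨k + 1, by omega, l'', h4, ?_, fun w => ?_⟩
      · rw [wordProd_append, wordProd_cons, wordProd_nil, mul_one, h2, mul_assoc, h5, pow_succ,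
          mul_assoc]
      · rcases w with _ | w
        · have := h3 0
          simp only [zero_add, pow_one] at this ⊢
          omega
        · calc weightCount (w + 1) l'' ≤ l.length ^ (w + 1 + 1) + l.length ^ (w + 1) :=
                (h7 w).trans (add_le_add (h3 _) (h3 _))
            _ = l.length ^ (w + 1) * (l.length + 1) := by ring
            _ ≤ (l.length + 1) ^ (w + 1) * (l.length + 1) :=
                Nat.mul_le_mul_right _ (Nat.pow_le_pow_left (Nat.le_succ _) _)
            _ = _ := (pow_succ _ _).symm
    · refine ⟨k, by omega, l' ++ [a], ?_, ?_, fun w => ?_⟩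
      · intro b hb
        rcases List.mem_append.1 hb with hb | hb
        · exact h1 b hb
        · rw [List.mem_singleton.1 hb]
          exact ⟨hl a (by simp), hat⟩
      · rw [wordProd_append, wordProd_append, h2, mul_assoc]
      · have h4 : weightCount w (l' ++ [a]) ≤ weightCount w l' + 1 := by
          simp only [weightCount, List.countP_append, List.countP_cons, List.countP_nil]
          split_ifs <;> omega
        have h5 : l.length ^ (w + 1) + 1 ≤ (l.length + 1) ^ (w + 1) :=
          Nat.pow_lt_pow_left (Nat.lt_succ_self _) (Nat.succ_ne_zero w)
        exact (h4.trans (Nat.add_le_add_right (h3 w) 1)).trans h5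

theorem length_eq_sum_weightCount {G : Type*} (c : ℕ) (l : List (G × ℕ)) (hl : ∀ a ∈ l, a.2 ≤ c) :
    l.length = ∑ w ∈ Finset.range (c + 1), weightCount w l := by
  induction l with
  | nil => simp [weightCount]
  | cons a l ih =>
    have h1 : ∀ w, weightCount w (a :: l) = weightCount w l + if w = a.2 then 1 else 0 := by
      intro w
      simp [weightCount, List.countP_cons, eq_comm]
    have h2 := hl a List.mem_cons_self
    simp only [h1, Finset.sum_add_distrib, Finset.sum_ite_eq', Finset.mem_range, List.length_cons]
    rw [← ih fun b hb => hl b (List.mem_cons_of_mem _ hb), if_pos (by omega)]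

/-- The elements that are products of at most `n` letters in `A`. -/
def wordBall (A : Set (G × ℕ)) (n : ℕ) : Set G :=
  {g | ∃ l : List (G × ℕ), (∀ a ∈ l, a ∈ A) ∧ l.length ≤ n ∧ wordProd l = g}

/-- Collecting a letter of least weight writes each product as a power of it, with exponent at most
`n`, times a word of polynomial length in the remaining letters, which are still closed under
commutators. Induction on the number of letters applies. -/
theorem exists_wordBall_le (N : ℕ) : ∀ A : Set (G × ℕ), A.Finite → A.ncard = N → IsCommClosed A →
    ∃ e : ℕ, ∀ n, (wordBall A n).encard ≤ ((n + 2) ^ e : ℕ) := by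
  induction N with
  | zero =>
    intro A hA hN _
    obtain rfl := (Set.ncard_eq_zero hA).1 hN
    refine ⟨0, fun n => ?_⟩
    rw [pow_zero, Nat.cast_one, Set.encard_le_one_iff]
    have key : ∀ g ∈ wordBall (∅ : Set (G × ℕ)) n, g = 1 := by
      rintro g ⟨l, hl, -, rfl⟩
      rw [List.eq_nil_iff_forall_not_mem.2 hl, wordProd_nil]
    intro g h hg hh
    rw [key g hg, key h hh]
  | succ N ih =>
    intro A hA hN hcl
    have hne : A.Nonempty := by
      rw [← Set.ncard_pos hA]
      omega
    obtain ⟨t, ht, hmin⟩ := Set.exists_min_image A Prod.snd hA hne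
    obtain ⟨m, -, hmax⟩ := Set.exists_max_image A Prod.snd hA hne
    obtain ⟨c, hc⟩ : ∃ c, c = m.2 := ⟨_, rfl⟩
    have hcl' : IsCommClosed (A \ {t}) := by
      intro a ha b hb hab
      refine (hcl a ha.1 b hb.1 hab).imp_right fun h => ⟨h, fun h' => ?_⟩
      have h1 : a.2 + 1 = t.2 := congrArg Prod.snd h'
      have h2 := hmin a ha.1
      omega
    obtain ⟨e, he⟩ := ih (A \ {t}) (hA.subset Set.sdiff_subset)
      (by rw [Set.ncard_sdiff_singleton_of_mem ht, hN, Nat.add_sub_cancel]) hcl'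
    refine ⟨1 + (2 * c + 4) * e, fun n => ?_⟩
    -- There are `c + 1` possible weights, and at most `(n + 1) ^ (c + 1)` letters of each.
    obtain ⟨L, hL⟩ : ∃ L, L = (c + 1) * (n + 1) ^ (c + 1) := ⟨_, rfl⟩
    have hsub : wordBall A n ⊆ (fun p : ℕ × G => t.1 ^ p.1 * p.2) ''
        ((Finset.range (n + 1) : Set ℕ) ×ˢ wordBall (A \ {t}) L) := by
      rintro _ ⟨l, hl, hln, rfl⟩
      obtain ⟨k, hk, l', h1, h2, h3⟩ := exists_collect hcl ht hmin l hl
      refine ⟨(k, wordProd l'), ⟨by simpa using by omega, l', h1, ?_, rfl⟩, h2.symm⟩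
      rw [length_eq_sum_weightCount c l' fun a ha => hc ▸ hmax a (h1 a ha).1, hL]
      calc ∑ w ∈ Finset.range (c + 1), weightCount w l'
          ≤ ∑ w ∈ Finset.range (c + 1), (n + 1) ^ (c + 1) := by
            refine Finset.sum_le_sum fun w hw => (h3 w).trans ?_
            have hw' := Finset.mem_range.1 hw
            exact (Nat.pow_le_pow_left (by omega) _).trans
              (Nat.pow_le_pow_right (Nat.succ_pos n) (by omega))
        _ = _ := by simp
    have hL2 : L + 2 ≤ (n + 2) ^ (2 * c + 4) := by
      have h1 : (n + 1) ^ (c + 1) ≤ (n + 2) ^ (c + 1) := Nat.pow_le_pow_left (by omega) _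
      have h2 : 1 ≤ (n + 2) ^ (c + 1) := Nat.one_le_pow _ _ (by omega)
      have h3 : c + 3 ≤ (n + 2) ^ (c + 3) :=
        (Nat.lt_two_pow_self (n := c + 3)).le.trans (Nat.pow_le_pow_left (by omega) _)
      calc L + 2 ≤ (c + 3) * (n + 2) ^ (c + 1) := by
            rw [hL]
            nlinarith [Nat.mul_le_mul_left (c + 1) h1]
        _ ≤ (n + 2) ^ (c + 3) * (n + 2) ^ (c + 1) := Nat.mul_le_mul_right _ h3
        _ = (n + 2) ^ (2 * c + 4) := by rw [← pow_add]; congr 1; ring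
    calc (wordBall A n).encard ≤ _ := Set.encard_le_encard hsub
      _ ≤ _ := Set.encard_image_le _ _
      _ = (n + 1 : ℕ) * (wordBall (A \ {t}) L).encard := by
        rw [Set.encard_prod, Set.encard_coe_eq_coe_finsetCard, Finset.card_range]
      _ ≤ (n + 2 : ℕ) * ((L + 2) ^ e : ℕ) :=
        mul_le_mul' (by exact_mod_cast Nat.le_succ _) (he L)
      _ ≤ (n + 2 : ℕ) * (((n + 2) ^ (2 * c + 4)) ^ e : ℕ) :=
        mul_le_mul' le_rfl (by exact_mod_cast Nat.pow_le_pow_left hL2 e)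
      _ = ((n + 2) ^ (1 + (2 * c + 4) * e) : ℕ) := by
        rw [← Nat.cast_mul, pow_add (n + 2) 1, pow_one, pow_mul]

open Classical in
/-- The iterated commutators of weight `w` of the elements of `S`, and those of weight at most `w`,
where the elements of `S` have weight `0`. -/
noncomputable def iteratedComm (S : Finset G) : ℕ → Finset G × Finset G
  | 0 => (S, S)
  | w + 1 =>
    let N := ((iteratedComm S w).1 ×ˢ (iteratedComm S w).2).image
      fun p => p.1⁻¹ * p.2⁻¹ * p.1 * p.2
    (N, (iteratedComm S w).2 ∪ N)

open Classical in
theorem iteratedComm_subset (S : Finset G) {j w : ℕ} (h : j ≤ w) :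
    (iteratedComm S j).1 ⊆ (iteratedComm S w).2 := by
  induction w with
  | zero =>
    obtain rfl := Nat.le_zero.1 h
    exact subset_rfl
  | succ w ih =>
    rcases Nat.lt_or_ge j (w + 1) with h' | h'
    · exact (ih (Nat.lt_succ_iff.1 h')).trans Finset.subset_union_left
    · obtain rfl := le_antisymm h h'
      exact Finset.subset_union_right

open Classical in
theorem comm_mem_iteratedComm {S : Finset G} {j w : ℕ} (h : j ≤ w) {a b : G}
    (ha : a ∈ (iteratedComm S w).1) (hb : b ∈ (iteratedComm S j).1) :
    a⁻¹ * b⁻¹ * a * b ∈ (iteratedComm S (w + 1)).1 :=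
  Finset.mem_image.2 ⟨(a, b), Finset.mem_product.2 ⟨ha, iteratedComm_subset S h hb⟩, rfl⟩

open Classical in
theorem iteratedComm_le (S : Finset G) (w : ℕ) :
    ∀ a ∈ (iteratedComm S w).1, a ∈ (⊤ : Subgroup G).lowerCentralSeries w := by
  induction w with
  | zero => exact fun a _ => Subgroup.mem_top a
  | succ w ih =>
    intro a ha
    obtain ⟨⟨u, t⟩, hp, rfl⟩ := Finset.mem_image.1 ha
    have h1 := ih u (Finset.mem_product.1 hp).1
    have h2 := Subgroup.commutator_mem_commutator (inv_mem h1) (Subgroup.mem_top t⁻¹)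
    rw [commutatorElement_def, inv_inv, inv_inv] at h2
    exact h2

/-- In a nilpotent group, the number of products of at most `n` elements of a finite set is bounded
by a polynomial in `n`. -/
theorem exists_encard_prod_le [Group.IsNilpotent G] (S : Finset G) :
    ∃ e : ℕ, ∀ n, {g | ∃ l : List G, (∀ a ∈ l, a ∈ S) ∧ l.length ≤ n ∧ l.prod = g}.encard ≤
      ((n + 2) ^ e : ℕ) := by
  obtain ⟨c, hc⟩ := Subgroup.nilpotent_iff_lowerCentralSeries.1 ‹Group.IsNilpotent G›
  -- Weights may stop at `c`: letters of weight `c` lie in the trivial term of the lower central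
  -- series, so their commutators vanish and `A` is closed.
  let A : Set (G × ℕ) := {a | a.2 ≤ c ∧ a.1 ∈ (iteratedComm S a.2).1}
  have hA : A.Finite := by
    refine ((Set.finite_Iic c).biUnion fun w _ =>
      ((iteratedComm S w).1.finite_toSet.image fun g => (g, w))).subset ?_
    rintro ⟨g, w⟩ ⟨h1, h2⟩
    exact Set.mem_biUnion (x := w) h1 (Set.mem_image_of_mem _ h2)
  have hcl : IsCommClosed A := by
    rintro ⟨a, i⟩ ⟨hi, ha⟩ ⟨b, j⟩ ⟨_, hb⟩ hji
    rcases Nat.lt_or_ge i c with h | h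
    · exact Or.inr ⟨h, comm_mem_iteratedComm hji ha hb⟩
    · obtain rfl : i = c := le_antisymm hi h
      have h1 := iteratedComm_le S _ a ha
      rw [hc, Subgroup.mem_bot] at h1
      subst h1
      left
      simp
  obtain ⟨e, he⟩ := exists_wordBall_le _ A hA rfl hcl
  refine ⟨e, fun n => (Set.encard_le_encard ?_).trans (he n)⟩
  rintro _ ⟨l, hl, hn, rfl⟩
  refine ⟨l.map fun g => (g, 0), fun a ha => ?_, by simpa using hn, ?_⟩
  · obtain ⟨g, hg, rfl⟩ := List.mem_map.1 ha
    exact ⟨Nat.zero_le c, hl g hg⟩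
  · simp [wordProd, Function.comp_def]

end Collection

/-! ### Cayley graphs and the choice of generators -/

section Cayley

variable {G : Type*} [Group G] {S : Set G}

/-- Left multiplication as an automorphism of a Cayley graph. -/
def mulLeftIso (S : Set G) (d : G) : SimpleGraph.mulCayley S ≃g SimpleGraph.mulCayley S where
  toEquiv := Equiv.mulLeft d
  map_rel_iff' := SimpleGraph.mulCayley_adj_mul_iff_right

@[simp] theorem mulLeftIso_apply (S : Set G) (d a : G) : mulLeftIso S d a = d * a := rfl

theorem mulCayley_isVertexTransitive : IsVertexTransitive (SimpleGraph.mulCayley S) :=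
  fun a b => ⟨mulLeftIso S (b * a⁻¹), by simp⟩

theorem mulCayley_isLocallyFinite (hS : S.Finite) :
    IsLocallyFinite (SimpleGraph.mulCayley S) := fun a => by
  refine ((hS.union hS.inv).image (a * ·)).subset fun b hb => ?_
  rw [SimpleGraph.mem_neighborSet, SimpleGraph.mulCayley_adj] at hb
  refine ⟨a⁻¹ * b, hb.2.imp id fun h => ?_, by simp⟩
  rw [Set.mem_inv]
  simpa using h

theorem mulCayley_connected (hS : Subgroup.closure S = ⊤) :
    (SimpleGraph.mulCayley S).Connected := by
  have key : ∀ g : G, ∀ a, (SimpleGraph.mulCayley S).Reachable a (a * g) := by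
    intro g
    have hg : g ∈ Subgroup.closure S := hS ▸ Subgroup.mem_top g
    induction hg using Subgroup.closure_induction with
    | mem s hs =>
      intro a
      by_cases h : a = a * s
      · rw [← h]
      · exact SimpleGraph.Adj.reachable
          ((SimpleGraph.mulCayley_adj S _ _).2 ⟨h, Or.inl (by simpa using hs)⟩)
    | one => intro a; rw [mul_one]
    | mul g h _ _ ihg ihh =>
      intro a
      rw [← mul_assoc]
      exact (ihg a).trans (ihh _)
    | inv g _ ih =>
      intro a
      simpa using (ih (a * g⁻¹)).symm
  exact ⟨fun a b => by simpa using key (a⁻¹ * b) a⟩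

/-- By left invariance it is enough to bound the `S'`-length of the finitely many elements of `S ∪
S⁻¹`. -/
theorem mulCayley_exists_dist_le {S S' : Set G} (hS : S.Finite) (hgen : Subgroup.closure S = ⊤)
    (hgen' : Subgroup.closure S' = ⊤) : ∃ K : ℕ, ∀ a b,
      (SimpleGraph.mulCayley S').dist a b ≤ K * (SimpleGraph.mulCayley S).dist a b := by
  obtain ⟨K, hK⟩ := exists_dist_le_of_finite (G := SimpleGraph.mulCayley S')
    (hS.union hS.inv) (1 : G)
  refine ⟨K, dist_le_of_adj (f := id) (mulCayley_connected hgen) (mulCayley_connected hgen')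
    fun a b hab => ?_⟩
  rw [SimpleGraph.mulCayley_adj] at hab
  have h1 := dist_iso (mulLeftIso S' a) 1 (a⁻¹ * b)
  have h2 := hK (a⁻¹ * b) (hab.2.imp id fun h => by rw [Set.mem_inv]; simpa using h)
  have h3 : (mulLeftIso S' a) 1 = a := by simp
  have h4 : (mulLeftIso S' a) (a⁻¹ * b) = b := by simp
  rw [h3, h4] at h1
  exact h1.le.trans h2

theorem mulCayley_coarseEquiv {S S' : Set G} (hS : S.Finite) (hS' : S'.Finite)
    (hgen : Subgroup.closure S = ⊤) (hgen' : Subgroup.closure S' = ⊤) :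
    CoarseEquiv (SimpleGraph.mulCayley S) (SimpleGraph.mulCayley S') ∧
      SameGrowthRate (SimpleGraph.mulCayley S) (SimpleGraph.mulCayley S') := by
  obtain ⟨K, hK⟩ := mulCayley_exists_dist_le hS hgen hgen'
  obtain ⟨K', hK'⟩ := mulCayley_exists_dist_le hS' hgen' hgen
  refine ⟨⟨id, id, K + K', fun a b => ?_, fun a b => ?_, fun a => by simp, fun a => by simp⟩,
    fun a b => ⟨?_, ?_⟩⟩
  · exact (hK a b).trans (by rw [add_mul]; omega)
  · exact (hK' a b).trans (by rw [add_mul]; omega)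
  · exact growthLE_of_map (mulCayley_connected hgen') (mulCayley_isLocallyFinite hS') id K 1
      (fun a b => (hK a b).trans (Nat.le_add_right _ _)) (fun w => by simp) a b
  · exact growthLE_of_map (mulCayley_connected hgen) (mulCayley_isLocallyFinite hS) id K' 1
      (fun a b => (hK' a b).trans (Nat.le_add_right _ _)) (fun w => by simp) b a

theorem mulCayley_exists_list {a b : G} (p : (SimpleGraph.mulCayley S).Walk a b) :
    ∃ l : List G, (∀ s ∈ l, s ∈ S ∪ S⁻¹) ∧ l.length = p.length ∧ a * l.prod = b := by
  induction p with
  | nil => exact ⟨[], by simp, rfl, by simp⟩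
  | @cons a c b h p ih =>
    obtain ⟨l, h1, h2, h3⟩ := ih
    rw [SimpleGraph.mulCayley_adj] at h
    refine ⟨(a⁻¹ * c) :: l, ?_, by simp [h2], by rw [List.prod_cons, ← mul_assoc]; simpa using h3⟩
    intro s hs
    rcases List.mem_cons.1 hs with rfl | hs
    · exact h.2.imp id fun h => by rw [Set.mem_inv]; simpa using h
    · exact h1 s hs

/-- The growth of a finitely generated nilpotent group is polynomially bounded. -/
theorem mulCayley_exists_growthLE [Group.IsNilpotent G] (hS : S.Finite)
    (hgen : Subgroup.closure S = ⊤) :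
    ∃ e : ℕ, GrowthLE (growthFun (SimpleGraph.mulCayley S) 1) fun n => n ^ e := by
  obtain ⟨e, he⟩ := exists_encard_prod_le (hS.union hS.inv).toFinset
  refine ⟨e, 2, fun n => ?_⟩
  have hsub : {g | (SimpleGraph.mulCayley S).dist 1 g ≤ n} ⊆
      {g | ∃ l : List G, (∀ a ∈ l, a ∈ (hS.union hS.inv).toFinset) ∧ l.length ≤ n ∧
        l.prod = g} := by
    intro g hg
    obtain ⟨p, hp⟩ := (mulCayley_connected hgen).exists_walk_length_eq_dist 1 g
    obtain ⟨l, h1, h2, h3⟩ := mulCayley_exists_list p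
    refine ⟨l, fun a ha => by simpa using h1 a ha, ?_, by simpa using h3⟩
    rw [h2, hp]
    exact hg
  have h1 := (Set.encard_le_encard hsub).trans (he n)
  have hfin := finite_ball (mulCayley_connected hgen) (mulCayley_isLocallyFinite hS) 1 n
  rw [← hfin.cast_ncard_eq, Nat.cast_le] at h1
  calc growthFun (SimpleGraph.mulCayley S) 1 n ≤ (n + 2) ^ e := h1
    _ ≤ (2 * n + 2) ^ e := Nat.pow_le_pow_left (by omega) e
    _ ≤ 2 * (2 * n + 2) ^ e := by omega

theorem hasPolynomialGrowthOrder_of_sameGrowthRate {V W : Type*} {X : SimpleGraph V}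
    {Y : SimpleGraph W} {a : V} {d : ℕ}
    (hd : IsLeast {e : ℕ | GrowthLE (growthFun X a) fun n => n ^ e} d)
    (h : SameGrowthRate Y X) : HasPolynomialGrowthOrder Y d := fun b => by
  have hmono : ∀ e : ℕ, Monotone fun n : ℕ => n ^ e := fun e _ _ hmn =>
    Nat.pow_le_pow_left hmn e
  exact ⟨(h b a).1.trans (hmono d) hd.1, fun e he => hd.2 ((h b a).2.trans (hmono e) he)⟩

end Cayley

end CoarseGraph

theorem mainTheorem3 :
    (∀ (V : Type u) (X : SimpleGraph V), Infinite V → IsLocallyFinite X → X.Connected →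
      IsVertexTransitive X →
      (∃ x : ℤ → V, IsGeodesicLine X x) ∧
      ∀ x : ℤ → V, IsGeodesicLine X x →
        ∃ Y : Set.Ioc (0 : ℝ) 1 → SimpleGraph ℕ,
          (∀ α, (Y α).Connected ∧ IsThreeRegular (Y α) ∧
            (attachSegments X x α).Connected ∧
            QuasiIsometric (Y α) (attachSegments X x α) ∧
            SameGrowthRate (Y α) X ∧ numEnds (Y α) = numEnds X ∧ asdim (Y α) = asdim X) ∧
          ∀ α β, α ≠ β → ¬ QuasiIsometric (Y α) (Y β)) ∧
    (∀ (G : Type v) [Group G], Infinite G → Group.FG G → Group.IsNilpotent G →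
      ∃ (Y : Set.Ioc (0 : ℝ) 1 → SimpleGraph ℕ) (d : ℕ),
        (∀ α, (Y α).Connected ∧ IsThreeRegular (Y α) ∧ HasPolynomialGrowthOrder (Y α) d) ∧
        (∀ S : Set G, S.Finite → Subgroup.closure S = ⊤ →
          HasPolynomialGrowthOrder (SimpleGraph.mulCayley S) d ∧
          ∀ α, SameGrowthRate (Y α) (SimpleGraph.mulCayley S) ∧
            numEnds (Y α) = numEnds (SimpleGraph.mulCayley S) ∧
            asdim (Y α) = asdim (SimpleGraph.mulCayley S)) ∧
        ∀ α β, α ≠ β → ¬ QuasiIsometric (Y α) (Y β)) := by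
  constructor
  · intro V X _ hl hX ht
    exact ⟨exists_geodesicLine hl hX ht, fun x hx => exists_threeRegular_family hl hX ht hx⟩
  · intro G _ _ hfg hnil
    -- The family and `d` are built from one generating set; every other one is compared with it by
    -- `mulCayley_coarseEquiv`.
    obtain ⟨S₀, hgen₀, hS₀⟩ := (Group.fg_iff (G := G)).1 hfg
    have hl₀ := mulCayley_isLocallyFinite hS₀
    have hc₀ := mulCayley_connected hgen₀
    obtain ⟨x, hx⟩ := exists_geodesicLine hl₀ hc₀ mulCayley_isVertexTransitive
    obtain ⟨Y, hY, hne⟩ := exists_threeRegular_family hl₀ hc₀ mulCayley_isVertexTransitive hx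
    obtain ⟨d, hd⟩ : ∃ d, IsLeast {e : ℕ | GrowthLE
        (growthFun (SimpleGraph.mulCayley S₀) 1) fun n => n ^ e} d := by
      classical
      exact ⟨_, Nat.isLeast_find (mulCayley_exists_growthLE hS₀ hgen₀)⟩
    refine ⟨Y, d, fun α => ?_, fun S hS hgen => ?_, hne⟩
    · obtain ⟨h1, h2, -, -, h3, -⟩ := hY α
      exact ⟨h1, h2, hasPolynomialGrowthOrder_of_sameGrowthRate hd h3⟩
    · have hl := mulCayley_isLocallyFinite hS
      have hc := mulCayley_connected hgen
      obtain ⟨he, hg⟩ := mulCayley_coarseEquiv hS₀ hS hgen₀ hgen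
      refine ⟨hasPolynomialGrowthOrder_of_sameGrowthRate hd
        (mulCayley_coarseEquiv hS hS₀ hgen hgen₀).2, fun α => ?_⟩
      obtain ⟨h1, h2, -, -, h3, h4, h5⟩ := hY α
      have hlY : IsLocallyFinite (Y α) :=
        isLocallyFinite_of_encard_le (Δ := 3) fun a => (h2 a).le
      exact ⟨h3.trans h1 hlY hc₀ hc hl hg, h4.trans (he.numEnds_eq hc₀ hl₀ hc hl),
        h5.trans (he.asdim_eq hc₀ hc)⟩
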